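/- Let $A\in\mathbb C^{N\times N}$ be diagonalizable, $A=Z\Lambda Z^{-1}$ with $\Lambda$ diagonal and $Z$ invertible, let $\rho(A)$ be its spectral radius, and let $\kappa(Z)=\|Z\|\,\|Z^{-1}\|$; norms of matrices are spectral (operator) norms. Let $p_0,p_1,\dots$ be the orthonormal Legendre polynomials on $[-1,1]$, let $\Theta(x)=1$ for $x\ge 0$ and $\Theta(x)=0$ for $x<0$, and let $$t_{k,\ell}=\int_{-1}^1\int_{-1}^1\Theta(\tau-\sigma)\,p_k(\tau)\,p_\ell(\sigma)\,d\sigma\,d\tau ,\qquad k,\ell\ge 0 .$$ For an integer $M\ge 2$ let $T_M$ be the $M\times M$ matrix with entries $t_{k,\ell}$ for $0\le k\le M-2$, $0\le \ell\le M-1$, and with last row equal to zero; let $\hat T_M$ be the infinite matrix obtained from $T_M$ by adding zero rows and columns, so that $A\otimes\hat T_M$ is a bounded operator on $\mathbb C^N\otimes\ell^2$. Let $\phi(t)=(p_0(t),\dots,p_{M-1}(t))^T$, let $e_1$ be the first unit vector of length $M$, and put $$E_M(t)=\exp(A(t+1))-(I\otimes\phi(t)^T)(I-A\otimes T_M)^{-1}(I\otimes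 e_1\sqrt2).$$ For $c\in\mathbb C$, $c\ne 0$, put $$\mu_M=\exp\left(\sqrt{\frac{9\rho(A)}{(M-1)|c|}}\right),\qquad K_M=\left|\left(|1-c|-|c|\mu_M\right)M\right|^{-1}+28\left\|(I-A\otimes\hat T_M)^{-1}\right\| .$$ Call $c$ admissible for $M$ if $c\ne1$ and the Taylor series $\sum_{k\ge0}(A\otimes T_M-cI)^k/(1-c)^{k+1}$ converges to $(I-A\otimes T_M)^{-1}$. 1. Let $M\ge2$ and let $c\neq 0$ be admissible for $M$. If $$M\ \ge\ \frac{9\rho(A)}{|c|}\left(\ln\frac{|1-c|}{|c|}\right)^{-2}+1\qquad\text{and}\qquad |1-c|\ne|c|\mu_M$$ (the latter says that $K_M$ is defined), then for all $t\in[-1,1]$ $$\|E_M(t)\|\ \le\ \kappa(Z)\,K_M\,M\left|\frac{c\,\mu_M}{1-c}\right|^{M-1}.$$ 2. Let $\rho(A)>0$. If $M\ge18\rho(A)+1$ and $c=-9\rho(A)/(M-1)$ is admissible for $M$, then, with $K_M$ formed with this $c$, for all $t\in[-1,1]$ $$\|E_M(t)\|\ \le\ \kappa(Z)\,K_M\,M\left|\frac{9\rho(A)e}{M-1}\right|^{M-1}.$$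 The right-hand side of this bound (with $c=-9\rho(A)/(M-1)$ in $K_M$ for each $M$) decays super-exponentially: for every $r>0$, its quotient by $r^M$ tends to $0$ as $M\to\infty$. -/

import Mathlib

open scoped Kronecker Matrix.Norms.L2Operator

namespace StarMethod

/-- The Heaviside step function, with value `1` at `0`. -/
noncomputable def heaviside (x : ℝ) : ℝ := if 0 ≤ x then 1 else 0

/-- The Legendre polynomial `P_n`, by the Rodrigues formula
`P_n = 1 / (2 ^ n * n!) * (d/dx)^n (x ^ 2 - 1) ^ n`. -/
noncomputable def legendre (n : ℕ) : Polynomial ℝ :=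
  Polynomial.C ((1 : ℝ) / (2 ^ n * (n.factorial : ℝ))) *
    Polynomial.derivative^[n] ((Polynomial.X ^ 2 - 1) ^ n)

/-- The `k`-th orthonormal Legendre polynomial on `[-1, 1]`. -/
noncomputable def orthoLegendre (k : ℕ) (t : ℝ) : ℝ :=
  Real.sqrt ((2 * (k : ℝ) + 1) / 2) * (legendre k).eval t

/-- The infinite coefficient matrix `T_∞` of the function `(t, s) ↦ Θ(t - s)` on `[-1, 1]²` with
respect to the orthonormal Legendre polynomials; indices start from `0`. -/
noncomputable def coeffInf (k l : ℕ) : ℝ :=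
  ∫ t in (-1 : ℝ)..1, ∫ s in (-1 : ℝ)..1,
    heaviside (t - s) * orthoLegendre k t * orthoLegendre l s

/-- The `M × M` matrix `T_M`: the leading block of `T_∞` with its last row set to zero. -/
noncomputable def coeffMatrix (M : ℕ) : Matrix (Fin M) (Fin M) ℂ :=
  Matrix.of fun k l => if (k : ℕ) + 1 = M then 0 else ((coeffInf k l : ℝ) : ℂ)

/-- The infinite matrix that keeps the first `M - 1` rows and the first `M` columns of `T_∞`,
all its other entries being zero. -/
noncomputable def coeffHat (M : ℕ) (k l : ℕ) : ℝ :=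
  if k + 1 < M ∧ l < M then coeffInf k l else 0

/-- The Hilbert space `ℂ^N ⊗ ℓ²(ℕ)`, as `ℓ²` over the index set `{1, …, N} × ℕ`. -/
abbrev Ell2 (N : ℕ) : Type := lp (fun _ : Fin N × ℕ => ℂ) 2

/-- The standard orthonormal basis vector of `Ell2 N` with index `p`. -/
noncomputable def stdVec {N : ℕ} (p : Fin N × ℕ) : Ell2 N := lp.single 2 p (1 : ℂ)

/-- The Kronecker product of `A` with the infinite matrix `coeffHat M`, as a bounded operator on
`ℂ^N ⊗ ℓ²(ℕ)`. All nonzero entries of `coeffHat M` have both indices below `M`. -/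
noncomputable def kronHat {N : ℕ} (A : Matrix (Fin N) (Fin N) ℂ) (M : ℕ) :
    Ell2 N →L[ℂ] Ell2 N :=
  ∑ i : Fin N, ∑ j : Fin N, ∑ k ∈ Finset.range M, ∑ l ∈ Finset.range M,
    (A i j * ((coeffHat M k l : ℝ) : ℂ)) •
      InnerProductSpace.rankOne ℂ (stdVec (i, k)) (stdVec (j, l))

theorem inner_stdVec {N : ℕ} (p q : Fin N × ℕ) :
    inner ℂ (stdVec p) (stdVec q) = if p = q then (1 : ℂ) else 0 := by
  unfold stdVec
  rw [lp.inner_single_left, lp.single_apply]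
  by_cases h : p = q
  · subst h; simp
  · simp [h]

/-- The entries of `kronHat A M` are those of the Kronecker product. -/
theorem kronHat_apply {N : ℕ} (A : Matrix (Fin N) (Fin N) ℂ) (M : ℕ) (p q : Fin N × ℕ) :
    inner ℂ (stdVec p) (kronHat A M (stdVec q)) =
      A p.1 q.1 * ((coeffHat M p.2 q.2 : ℝ) : ℂ) := by
  obtain ⟨i, k⟩ := p
  obtain ⟨j, l⟩ := q
  simp only [kronHat, sum_apply, smul_apply, inner_sum,
    inner_smul_right, InnerProductSpace.rankOne_apply, inner_stdVec, Prod.mk.injEq]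
  rw [Finset.sum_eq_single i _ (by simp), Finset.sum_eq_single j _ (by simp),
    Finset.sum_eq_single k, Finset.sum_eq_single l]
  · simp
  · intro b _ hb; simp [hb]
  · intro h
    have : ¬ l < M := by simpa using h
    simp [coeffHat, this]
  · intro b _ hb; simp [hb.symm]
  · intro h
    have : ¬ k < M := by simpa using h
    have h2 : ¬ k + 1 < M := by omega
    simp [coeffHat, h2]
  · intro b _ hb; simp [hb]
  · intro b _ hb; simp [hb.symm]

/-- The column vector `φ_M(t) = (p_0(t), …, p_{M-1}(t))ᵀ`, with complex entries. -/
noncomputable def phi (M : ℕ) (t : ℝ) : Fin M → ℂ := fun k => ((orthoLegendre k t : ℝ) : ℂ)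

/-- The vector `√2 e₁` of length `M`. -/
noncomputable def e1Sqrt2 (M : ℕ) : Fin M → ℂ :=
  fun k => if (k : ℕ) = 0 then ((Real.sqrt 2 : ℝ) : ℂ) else 0

/-- The truncated approximation `(I ⊗ φ(t)ᵀ) (I - A ⊗ T_M)⁻¹ (I ⊗ e₁ √2)` of `exp (A (t + 1))`;
the `submatrix` only identifies the index set `Fin N × Unit` with `Fin N`. -/
noncomputable def starApprox {N : ℕ} (A : Matrix (Fin N) (Fin N) ℂ) (M : ℕ) (t : ℝ) :
    Matrix (Fin N) (Fin N) ℂ :=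
  (((1 : Matrix (Fin N) (Fin N) ℂ) ⊗ₖ Matrix.replicateRow Unit (phi M t)) *
      (1 - A ⊗ₖ coeffMatrix M)⁻¹ *
      ((1 : Matrix (Fin N) (Fin N) ℂ) ⊗ₖ Matrix.replicateCol Unit (e1Sqrt2 M))).submatrix
    (fun i => (i, ())) (fun j => (j, ()))

/-- The error of the truncated approximation, in the spectral norm. -/
noncomputable def truncError {N : ℕ} (A : Matrix (Fin N) (Fin N) ℂ) (M : ℕ) (t : ℝ) : ℝ :=
  ‖NormedSpace.exp (((t + 1 : ℝ) : ℂ) • A) - starApprox A M t‖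

/-- `(I - B)⁻¹` is the sum of the convergent Taylor series of `z ↦ (1 - z)⁻¹` centred at `c`,
evaluated at `B`. -/
def HasTaylorExpansionAt {ι : Type} [Fintype ι] [DecidableEq ι] (B : Matrix ι ι ℂ) (c : ℂ) :
    Prop :=
  c ≠ 1 ∧ Filter.Tendsto
    (fun n : ℕ => ∑ k ∈ Finset.range n, ((1 - c) ^ (k + 1))⁻¹ • (B - c • (1 : Matrix ι ι ℂ)) ^ k)
    Filter.atTop (nhds (1 - B)⁻¹)

/-- The spectral radius `ρ(A)` as a real number. -/
noncomputable def rho {N : ℕ} (A : Matrix (Fin N) (Fin N) ℂ) : ℝ := (spectralRadius ℂ A).toReal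

/-- The condition number `κ(Z) = ‖Z‖ ‖Z⁻¹‖` in the spectral norm. -/
noncomputable def kappa {N : ℕ} (Z : Matrix (Fin N) (Fin N) ℂ) : ℝ := ‖Z‖ * ‖Z⁻¹‖

/-- `μ_M = exp √(9 ρ(A) / ((M - 1) |c|))`. -/
noncomputable def mu {N : ℕ} (A : Matrix (Fin N) (Fin N) ℂ) (M : ℕ) (c : ℂ) : ℝ :=
  Real.exp (Real.sqrt (9 * rho A / (((M : ℝ) - 1) * ‖c‖)))

/-- `K_M = |(|1 - c| - |c| μ_M) M|⁻¹ + 28 ‖(I - A ⊗ T̂_M)⁻¹‖`, where the last norm is the operator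
norm on `ℂ^N ⊗ ℓ²(ℕ)`. -/
noncomputable def bigK {N : ℕ} (A : Matrix (Fin N) (Fin N) ℂ) (M : ℕ) (c : ℂ) : ℝ :=
  |(‖1 - c‖ - ‖c‖ * mu A M c) * (M : ℝ)|⁻¹ + 28 * ‖Ring.inverse (1 - kronHat A M)‖

/-- The centre `c = -9 ρ(A) / (M - 1)`. -/
noncomputable def centre {N : ℕ} (A : Matrix (Fin N) (Fin N) ℂ) (M : ℕ) : ℂ :=
  ((-(9 * rho A / ((M : ℝ) - 1)) : ℝ) : ℂ)

/-- The right-hand side `κ(Z) K_M M |9 ρ(A) e / (M - 1)|^(M - 1)` of the bound for the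
centre `c = -9 ρ(A) / (M - 1)`. -/
noncomputable def superBound {N : ℕ} (A Z : Matrix (Fin N) (Fin N) ℂ) (M : ℕ) : ℝ :=
  kappa Z * bigK A M (centre A M) * (M : ℝ) *
    |9 * rho A * Real.exp 1 / ((M : ℝ) - 1)| ^ (M - 1)

end StarMethod

namespace StarMethod

open Polynomial in
theorem iterate_derivative_sq_sub_one_pow (n m : ℕ) :
    (X ^ 2 - 1 : ℝ[X]) * derivative^[m + 2] ((X ^ 2 - 1) ^ n) +
      C (2 * ((m : ℝ) + 1) - 2 * n) * X * derivative^[m + 1] ((X ^ 2 - 1) ^ n) +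
      C (((m : ℝ) + 1) * m - 2 * n * (m + 1)) * derivative^[m] ((X ^ 2 - 1) ^ n) = 0 := by
  induction m with
  | zero =>
    have h : (X ^ 2 - 1 : ℝ[X]) * derivative ((X ^ 2 - 1) ^ n) =
        C (2 * (n : ℝ)) * X * (X ^ 2 - 1) ^ n := by
      rcases n with _ | n
      · simp
      · rw [derivative_pow]
        simp only [Nat.add_sub_cancel, derivative_sub, derivative_X_pow, derivative_one]
        simp only [map_mul, map_natCast, map_ofNat]
        push_cast
        ring
    have h2 := congrArg derivative h
    simp only [derivative_mul, derivative_sub, derivative_X_pow, derivative_one, derivative_C,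
      derivative_X] at h2
    simp only [Function.iterate_succ', Function.comp, Function.iterate_zero, id]
    simp only [map_mul, map_natCast, map_ofNat, map_sub, map_add, map_one] at h2 ⊢
    push_cast at h2 ⊢
    linear_combination h2
  | succ m ih =>
    have h2 := congrArg derivative ih
    simp only [derivative_mul, derivative_sub, derivative_add, derivative_X_pow, derivative_one,
      derivative_C, derivative_X, ← Function.iterate_succ_apply' derivative, derivative_zero] at h2
    simp only [map_mul, map_natCast, map_ofNat, map_sub, map_add, map_one, Nat.succ_eq_add_one]
      at h2 ⊢
    push_cast at h2 ⊢
    simp only [add_assoc, Nat.reduceAdd] at h2 ⊢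
    linear_combination h2

open Polynomial in
/-- The Legendre differential equation. -/
theorem legendre_ode (n : ℕ) :
    (X ^ 2 - 1 : ℝ[X]) * derivative (derivative (legendre n)) + 2 * X * derivative (legendre n) =
      C ((n : ℝ) * (n + 1)) * legendre n := by
  have h := iterate_derivative_sq_sub_one_pow n n
  simp only [legendre, derivative_C_mul, ← Function.iterate_succ_apply' derivative]
  simp only [map_mul, map_natCast, map_ofNat, map_sub, map_add, map_one, Nat.succ_eq_add_one]
    at h ⊢
  simp only [add_assoc, Nat.reduceAdd] at h ⊢
  linear_combination C ((1 : ℝ) / (2 ^ n * (n.factorial : ℝ))) * h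

open Polynomial in
theorem legendre_eval_one (n : ℕ) : (legendre n).eval 1 = 1 := by
  have h := aeval_iterate_derivative_self (A := ℝ) ((X ^ 2 - 1 : ℝ[X]) ^ n) n
    (p' := (X + 1) ^ n) (1 : ℝ) (by simp only [← mul_pow]; simp; ring)
  simp only [coe_aeval_eq_eval] at h
  rw [legendre, eval_mul, h]
  simp
  norm_num
  field_simp

open Polynomial in
theorem legendre_eval_neg_one (n : ℕ) : (legendre n).eval (-1) = (-1) ^ n := by
  have h := aeval_iterate_derivative_self (A := ℝ) ((X ^ 2 - 1 : ℝ[X]) ^ n) n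
    (p' := (X - 1) ^ n) (-1 : ℝ) (by simp only [← mul_pow]; simp; ring)
  simp only [coe_aeval_eq_eval] at h
  rw [legendre, eval_mul, h]
  simp
  norm_num
  rw [show (-2 : ℝ) ^ n = (-1) ^ n * 2 ^ n by rw [← mul_pow]; norm_num]
  field_simp

open Polynomial in
theorem natDegree_legendre (n : ℕ) : (legendre n).natDegree = n := by
  have hd : ((X ^ 2 - 1 : ℝ[X]) ^ n).natDegree = 2 * n := by
    have : (X ^ 2 - 1 : ℝ[X]).natDegree = 2 := by
      simpa using natDegree_X_pow_sub_C (n := 2) (r := (1 : ℝ))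
    rw [natDegree_pow, this, mul_comm]
  have hm : ((X ^ 2 - 1 : ℝ[X]) ^ n).Monic := by
    apply Monic.pow
    simpa using monic_X_pow_sub_C (1 : ℝ) (n := 2) (by norm_num)
  rw [legendre, natDegree_C_mul (by positivity)]
  apply le_antisymm
  · refine (natDegree_iterate_derivative _ n).trans ?_
    rw [hd]; omega
  · apply le_natDegree_of_ne_zero
    rw [coeff_iterate_derivative]
    have hc : ((X ^ 2 - 1 : ℝ[X]) ^ n).coeff (n + n) = 1 := by
      have := hm.coeff_natDegree
      rwa [hd, two_mul] at this
    rw [hc]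
    simp [Nat.descFactorial_eq_zero_iff_lt]

open Polynomial in
/-- The energy of the Legendre equation is at most one on `[-1, 1]`. -/
theorem legendre_energy_le {n : ℕ} (hn : n ≠ 0) {t : ℝ} (ht : t ∈ Set.Icc (-1 : ℝ) 1) :
    (legendre n).eval t ^ 2 +
      (1 - t ^ 2) * (derivative (legendre n)).eval t ^ 2 / (n * (n + 1)) ≤ 1 := by
  have hnn : (0 : ℝ) < n * (n + 1) := by positivity
  set P := legendre n with hP
  obtain ⟨a, ha⟩ : ∃ a : ℝ, a = 1 / (n * (n + 1)) := ⟨_, rfl⟩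
  have ha0 : a * (n * (n + 1)) = 1 := by rw [ha, one_div_mul_cancel hnn.ne']
  set F : ℝ[X] := P ^ 2 + C a * ((1 - X ^ 2) * derivative P ^ 2) with hF
  have hFe : ∀ x, F.eval x = P.eval x ^ 2 +
      (1 - x ^ 2) * (derivative P).eval x ^ 2 / (n * (n + 1)) := by
    intro x
    rw [div_eq_mul_one_div, ← ha]
    simp [hF]; ring
  have hF' : derivative F = C (2 * a) * X * derivative P ^ 2 := by
    have ho := legendre_ode n
    rw [← hP] at ho
    have e : C a * C ((n : ℝ) * (n + 1)) = 1 := by rw [← C_mul, ha0, C_1]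
    simp only [hF, derivative_add, derivative_mul, derivative_sub, derivative_C,
      derivative_one, sq, derivative_X, C_mul, C_ofNat]
    linear_combination (-2 * C a * derivative P) * ho - 2 * P * derivative P * e
  rw [← hFe]
  have hd : ∀ x, deriv (fun y => F.eval y) x =
      2 * a * x * (derivative P).eval x ^ 2 := by
    intro x; rw [Polynomial.deriv, hF']; simp
  rcases le_total 0 t with h0 | h0
  · have hmono : MonotoneOn (fun y => F.eval y) (Set.Icc 0 1) := by
      apply monotoneOn_of_deriv_nonneg (convex_Icc _ _) F.continuous.continuousOn
        F.differentiable.differentiableOn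
      intro x hx
      rw [interior_Icc] at hx
      rw [hd]
      have := hx.1
      have : 0 < a := by rw [ha]; positivity
      positivity
    have := hmono ⟨h0, ht.2⟩ ⟨zero_le_one, le_rfl⟩ ht.2
    simpa [hFe, hP, legendre_eval_one] using this
  · have hmono : AntitoneOn (fun y => F.eval y) (Set.Icc (-1) 0) := by
      apply antitoneOn_of_deriv_nonpos (convex_Icc _ _) F.continuous.continuousOn
        F.differentiable.differentiableOn
      intro x hx
      rw [interior_Icc] at hx
      rw [hd]
      have h1 : 2 * a * x ≤ 0 :=
        mul_nonpos_of_nonneg_of_nonpos (by rw [ha]; positivity) hx.2.le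
      exact mul_nonpos_of_nonpos_of_nonneg h1 (sq_nonneg _)
    have := hmono ⟨le_rfl, by norm_num⟩ ⟨ht.1, h0⟩ ht.1
    simpa [hFe, hP, legendre_eval_neg_one, ← pow_mul] using this

open Polynomial in
theorem abs_legendre_eval_le {n : ℕ} {t : ℝ} (ht : t ∈ Set.Icc (-1 : ℝ) 1) :
    |(legendre n).eval t| ≤ 1 := by
  rcases eq_or_ne n 0 with rfl | hn
  · simp [legendre]
  · have h := legendre_energy_le hn ht
    have h1 : 0 ≤ (1 - t ^ 2) * (derivative (legendre n)).eval t ^ 2 / (n * (n + 1)) := by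
      have : 0 ≤ 1 - t ^ 2 := by nlinarith [ht.1, ht.2]
      positivity
    rw [abs_le_one_iff_mul_self_le_one]
    nlinarith

open Polynomial in
theorem legendre_derivative_sq_le {n : ℕ} {t : ℝ} (ht : t ∈ Set.Icc (-1 : ℝ) 1) :
    (1 - t ^ 2) * (derivative (legendre n)).eval t ^ 2 ≤ n * (n + 1) := by
  rcases eq_or_ne n 0 with rfl | hn
  · simp [legendre]
  · have hnn : (0 : ℝ) < n * (n + 1) := by positivity
    have h := legendre_energy_le hn ht
    rw [← div_le_one hnn]
    nlinarith [sq_nonneg ((legendre n).eval t)]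

/-- Integrals of derivatives of polynomials. -/
theorem integral_eval_derivative (F : Polynomial ℝ) (a b : ℝ) :
    ∫ x in a..b, (Polynomial.derivative F).eval x = F.eval b - F.eval a :=
  intervalIntegral.integral_eq_sub_of_hasDerivAt (fun x _ => F.hasDerivAt x)
    ((Polynomial.derivative F).continuous.intervalIntegrable _ _)

open Polynomial in
theorem integral_legendre_mul_legendre {m n : ℕ} (h : m ≠ n) :
    ∫ x in (-1 : ℝ)..1, (legendre m * legendre n).eval x = 0 := by
  set F : ℝ[X] := (1 - X ^ 2) * (derivative (legendre m) * legendre n -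
    derivative (legendre n) * legendre m) with hF
  have hF' : derivative F =
      C ((n : ℝ) * (n + 1) - (m : ℝ) * (m + 1)) * (legendre m * legendre n) := by
    have h1 := legendre_ode m
    have h2 := legendre_ode n
    simp only [hF, derivative_mul, derivative_sub, derivative_one, sq, derivative_X, C_sub]
    linear_combination -legendre n * h1 + legendre m * h2
  have hI := integral_eval_derivative F (-1) 1
  rw [hF'] at hI
  simp only [eval_mul, eval_C, intervalIntegral.integral_const_mul] at hI
  have hne : (n : ℝ) * (n + 1) - (m : ℝ) * (m + 1) ≠ 0 := by
    have : (n : ℝ) * (n + 1) - (m : ℝ) * (m + 1) = (n - m) * (n + m + 1) := by ring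
    rw [this]
    refine mul_ne_zero (sub_ne_zero.mpr (by exact_mod_cast h.symm)) (by positivity)
  have : F.eval 1 - F.eval (-1) = 0 := by simp [hF]
  rw [this] at hI
  simpa [eval_mul] using (mul_eq_zero.mp hI).resolve_left hne

open Polynomial in
/-- The Legendre polynomials as a polynomial sequence. -/
noncomputable def legendreSequence : Polynomial.Sequence ℝ where
  elems' := legendre
  degree_eq' n := by
    rw [degree_eq_iff_natDegree_eq (by
      intro h; have := legendre_eval_one n; simp [h] at this), natDegree_legendre]

open Polynomial in
theorem exists_sum_legendre {M : ℕ} {f : ℝ[X]} (hf : f.degree < M) :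
    ∃ a : ℕ → ℝ, f = ∑ k ∈ Finset.range M, C (a k) * legendre k := by
  have h1 : f ∈ degreeLT ℝ M := mem_degreeLT.mpr hf
  rw [← legendreSequence.span_degreeLT
    (fun i _ => IsUnit.mk0 _ (leadingCoeff_ne_zero.mpr (legendreSequence.ne_zero i)))] at h1
  have h2 : (Set.Iio M : Set ℕ) = (Finset.range M : Finset ℕ) := by ext; simp
  rw [h2, Submodule.mem_span_image_finset_iff_exists_fun] at h1
  obtain ⟨a, ha⟩ := h1
  refine ⟨fun k => if h : k ∈ Finset.range M then a ⟨k, h⟩ else 0, ?_⟩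
  rw [← ha, ← Finset.sum_attach (Finset.range M), Finset.univ_eq_attach]
  refine Finset.sum_congr rfl fun k _ => ?_
  simp only [dif_pos k.2, smul_eq_C_mul]
  rfl

open Polynomial in
theorem integral_eval_sum {ι : Type*} (s : Finset ι) (f : ι → ℝ[X]) (a b : ℝ) :
    ∫ x in a..b, (∑ k ∈ s, f k).eval x = ∑ k ∈ s, ∫ x in a..b, (f k).eval x := by
  simp only [eval_finsetSum]
  exact intervalIntegral.integral_finsetSum fun i _ => (f i).continuous.intervalIntegrable _ _

open Polynomial in
theorem integral_eval_C_mul (c : ℝ) (f : ℝ[X]) (a b : ℝ) :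
    ∫ x in a..b, (C c * f).eval x = c * ∫ x in a..b, f.eval x := by
  simp [intervalIntegral.integral_const_mul]

open Polynomial in
theorem integral_eval_add (f g : ℝ[X]) (a b : ℝ) :
    ∫ x in a..b, (f + g).eval x = (∫ x in a..b, f.eval x) + ∫ x in a..b, g.eval x := by
  simp only [eval_add]
  exact intervalIntegral.integral_add (f.continuous.intervalIntegrable _ _)
    (g.continuous.intervalIntegrable _ _)

open Polynomial in
theorem integral_mul_legendre_of_degree_lt {n : ℕ} {f : ℝ[X]} (hf : f.degree < n) :
    ∫ x in (-1 : ℝ)..1, (f * legendre n).eval x = 0 := by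
  obtain ⟨a, rfl⟩ := exists_sum_legendre hf
  rw [Finset.sum_mul, integral_eval_sum]
  refine Finset.sum_eq_zero fun k hk => ?_
  rw [mul_assoc, integral_eval_C_mul,
    integral_legendre_mul_legendre (Finset.mem_range.mp hk).ne, mul_zero]

open Polynomial in
theorem integral_legendre_mul_self (n : ℕ) :
    ∫ x in (-1 : ℝ)..1, (legendre n * legendre n).eval x = 2 / (2 * n + 1) := by
  set P := legendre n with hP
  set r : ℝ[X] := X * derivative P - C (n : ℝ) * P with hr
  have hdeg : P.natDegree = n := natDegree_legendre n
  have hrd : r.degree < n := by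
    rw [degree_lt_iff_coeff_zero]
    intro m hm
    rcases m with _ | m
    · obtain rfl : n = 0 := by omega
      simp [hr]
    · rw [hr, coeff_sub, coeff_X_mul, coeff_derivative, coeff_C_mul]
      rcases hm.eq_or_lt with rfl | hlt
      · push_cast; ring
      · rw [coeff_eq_zero_of_natDegree_lt (by rw [hdeg]; exact hlt)]; simp
  have h0 := integral_mul_legendre_of_degree_lt hrd
  have hI := integral_eval_derivative (X * (P * P)) (-1) 1
  have hd : derivative (X * (P * P)) = C (2 * (n : ℝ) + 1) * (P * P) + C 2 * (r * P) := by
    simp only [hr, derivative_mul, derivative_X, C_add, C_mul, C_1, C_ofNat]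
    ring
  rw [hd, integral_eval_add, integral_eval_C_mul, integral_eval_C_mul, h0] at hI
  have e : (X * (P * P)).eval 1 - (X * (P * P)).eval (-1) = 2 := by
    simp only [eval_mul, eval_X, hP, legendre_eval_one, legendre_eval_neg_one]
    rw [← mul_pow]
    norm_num
  rw [e] at hI
  rw [eq_div_iff (by positivity)]
  linarith

/-- The orthonormal Legendre polynomial as a polynomial. -/
noncomputable def orthoPoly (k : ℕ) : Polynomial ℝ :=
  Polynomial.C (Real.sqrt ((2 * (k : ℝ) + 1) / 2)) * legendre k

theorem orthoPoly_eval (k : ℕ) (t : ℝ) : (orthoPoly k).eval t = orthoLegendre k t := by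
  simp [orthoPoly, orthoLegendre]

theorem integral_orthoPoly_mul (m n : ℕ) :
    ∫ x in (-1 : ℝ)..1, (orthoPoly m * orthoPoly n).eval x = if m = n then 1 else 0 := by
  rw [orthoPoly, orthoPoly, mul_mul_mul_comm, ← Polynomial.C_mul, integral_eval_C_mul]
  split_ifs with h
  · subst h
    rw [integral_legendre_mul_self, Real.mul_self_sqrt (by positivity)]
    field_simp
  · rw [integral_legendre_mul_legendre h, mul_zero]

/-- The coefficient of a polynomial with respect to `orthoPoly k`. -/
noncomputable def orthoCoef (f : Polynomial ℝ) (k : ℕ) : ℝ :=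
  ∫ x in (-1 : ℝ)..1, (f * orthoPoly k).eval x

open Polynomial in
theorem eq_sum_orthoCoef {M : ℕ} {f : ℝ[X]} (hf : f.degree < M) :
    f = ∑ k ∈ Finset.range M, C (orthoCoef f k) * orthoPoly k := by
  obtain ⟨a, ha⟩ := exists_sum_legendre hf
  have hpos : ∀ k : ℕ, Real.sqrt ((2 * (k : ℝ) + 1) / 2) ≠ 0 := fun k => by positivity
  obtain ⟨b, hb⟩ : ∃ b : ℕ → ℝ, f = ∑ k ∈ Finset.range M, C (b k) * orthoPoly k := by
    refine ⟨fun k => a k / Real.sqrt ((2 * (k : ℝ) + 1) / 2), ha.trans ?_⟩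
    refine Finset.sum_congr rfl fun k _ => ?_
    rw [orthoPoly, ← mul_assoc, ← C_mul, div_mul_cancel₀ _ (hpos k)]
  have hc : ∀ k ∈ Finset.range M, orthoCoef f k = b k := by
    intro k hk
    rw [orthoCoef, hb, Finset.sum_mul, integral_eval_sum]
    simp only [mul_assoc, integral_eval_C_mul, integral_orthoPoly_mul]
    simpa using fun h => absurd (Finset.mem_range.mp hk) (not_lt.mpr h)
  conv_lhs => rw [hb]
  exact Finset.sum_congr rfl fun k hk => by rw [hc k hk]

open Polynomial in
theorem integral_mul_eq_sum_orthoCoef {M : ℕ} {f : ℝ[X]} (hf : f.degree < M) (g : ℝ[X]) :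
    ∫ x in (-1 : ℝ)..1, (f * g).eval x =
      ∑ k ∈ Finset.range M, orthoCoef f k * orthoCoef g k := by
  conv_lhs => rw [eq_sum_orthoCoef hf]
  rw [Finset.sum_mul, integral_eval_sum]
  refine Finset.sum_congr rfl fun k _ => ?_
  rw [mul_assoc, integral_eval_C_mul, orthoCoef, orthoCoef, mul_comm (orthoPoly k) g]

open Polynomial in
theorem orthoCoef_eq_zero {k : ℕ} {f : ℝ[X]} (hf : f.degree < k) : orthoCoef f k = 0 := by
  rw [orthoCoef, orthoPoly, mul_left_comm, integral_eval_C_mul,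
    integral_mul_legendre_of_degree_lt hf, mul_zero]

theorem abs_orthoLegendre_le {k : ℕ} {t : ℝ} (ht : t ∈ Set.Icc (-1 : ℝ) 1) :
    |orthoLegendre k t| ≤ Real.sqrt ((2 * (k : ℝ) + 1) / 2) := by
  rw [orthoLegendre, abs_mul, abs_of_nonneg (Real.sqrt_nonneg _)]
  exact mul_le_of_le_one_right (Real.sqrt_nonneg _) (abs_legendre_eval_le ht)

theorem sum_orthoLegendre_sq_le (M : ℕ) {t : ℝ} (ht : t ∈ Set.Icc (-1 : ℝ) 1) :
    ∑ k ∈ Finset.range M, orthoLegendre k t ^ 2 ≤ (M : ℝ) ^ 2 / 2 := by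
  induction M with
  | zero => simp
  | succ M ih =>
    rw [Finset.sum_range_succ]
    have h := pow_le_pow_left₀ (abs_nonneg _) (abs_orthoLegendre_le (k := M) ht) 2
    rw [sq_abs, Real.sq_sqrt (by positivity)] at h
    push_cast
    linarith

theorem integral_abs_orthoLegendre_le (k : ℕ) :
    ∫ x in (-1 : ℝ)..1, |orthoLegendre k x| ≤ 2 := by
  have h1 : ∫ x in (-1 : ℝ)..1, ((orthoPoly k * orthoPoly k).eval x + 1) / 2 = 3 / 2 := by
    rw [intervalIntegral.integral_div, intervalIntegral.integral_add
      ((Polynomial.continuous _).intervalIntegrable _ _) (by simp), integral_orthoPoly_mul]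
    norm_num
  have h2 : ∫ x in (-1 : ℝ)..1, |orthoLegendre k x| ≤
      ∫ x in (-1 : ℝ)..1, ((orthoPoly k * orthoPoly k).eval x + 1) / 2 := by
    apply intervalIntegral.integral_mono_on (by norm_num)
    · simp only [← orthoPoly_eval]
      exact (orthoPoly k).continuous.abs.intervalIntegrable _ _
    · apply Continuous.intervalIntegrable
      exact ((Polynomial.continuous _).add continuous_const).div_const _
    · intro x _
      rw [Polynomial.eval_mul, orthoPoly_eval]
      nlinarith [sq_nonneg (|orthoLegendre k x| - 1), abs_mul_abs_self (orthoLegendre k x)]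
  linarith

/-- The primitive of a polynomial that vanishes at `-1`. -/
noncomputable def primitive (f : Polynomial ℝ) : Polynomial ℝ :=
  (f.sum fun n a => Polynomial.C (a / (n + 1)) * Polynomial.X ^ (n + 1)) -
    Polynomial.C ((f.sum fun n a => Polynomial.C (a / (n + 1)) * Polynomial.X ^ (n + 1)).eval (-1))

open Polynomial in
theorem derivative_primitive (f : ℝ[X]) : derivative (primitive f) = f := by
  rw [primitive, derivative_sub, derivative_C, sub_zero, Polynomial.sum, derivative_sum]
  conv_rhs => rw [f.as_sum_support_C_mul_X_pow]
  refine Finset.sum_congr rfl fun n _ => ?_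
  rw [derivative_C_mul, derivative_X_pow, ← mul_assoc, ← C_mul]
  push_cast
  rw [div_mul_cancel₀ _ (by positivity)]

theorem primitive_eval_neg_one (f : Polynomial ℝ) : (primitive f).eval (-1) = 0 := by
  simp [primitive]

open Polynomial in
theorem eq_primitive {F f : ℝ[X]} (h : derivative F = f) (h1 : F.eval (-1) = 0) :
    F = primitive f := by
  have h2 : derivative (F - primitive f) = 0 := by
    rw [derivative_sub, h, derivative_primitive, sub_self]
  have h3 := eq_C_of_derivative_eq_zero h2
  have h4 := congrArg (fun p => p.eval (-1)) h3
  simp only [eval_sub, h1, primitive_eval_neg_one, eval_C, sub_self] at h4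
  rw [← h4, C_0] at h3
  exact sub_eq_zero.mp h3

open Polynomial in
theorem primitive_sum {ι : Type*} (s : Finset ι) (a : ι → ℝ) (f : ι → ℝ[X]) :
    primitive (∑ k ∈ s, C (a k) * f k) = ∑ k ∈ s, C (a k) * primitive (f k) := by
  symm
  apply eq_primitive
  · simp [derivative_primitive]
  · simp [eval_finsetSum, primitive_eval_neg_one]

open Polynomial in
theorem degree_primitive_lt {f : ℝ[X]} {M : ℕ} (hf : f.degree < M) :
    (primitive f).degree < (M + 1 : ℕ) := by
  rw [degree_lt_iff_coeff_zero] at hf ⊢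
  intro m hm
  obtain ⟨m, rfl⟩ : ∃ k, m = k + 1 := ⟨m - 1, by omega⟩
  have := hf m (by omega)
  rw [← derivative_primitive f, coeff_derivative] at this
  exact (mul_eq_zero.mp this).resolve_right (by positivity)

theorem integral_eval_eq_primitive (f : Polynomial ℝ) (t : ℝ) :
    ∫ x in (-1 : ℝ)..t, f.eval x = (primitive f).eval t := by
  have := integral_eval_derivative (primitive f) (-1) t
  rwa [derivative_primitive, primitive_eval_neg_one, sub_zero] at this

theorem coeffInf_eq (k l : ℕ) : coeffInf k l = orthoCoef (primitive (orthoPoly l)) k := by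
  rw [coeffInf, orthoCoef]
  apply intervalIntegral.integral_congr
  intro t ht
  rw [Set.uIcc_of_le (by norm_num)] at ht
  have hi1 : ∫ s in (-1 : ℝ)..t, heaviside (t - s) * orthoLegendre k t * orthoLegendre l s =
      ∫ s in (-1 : ℝ)..t, orthoLegendre k t * (orthoPoly l).eval s := by
    apply intervalIntegral.integral_congr
    intro s hs
    rw [Set.uIcc_of_le ht.1] at hs
    simp [heaviside, hs.2, orthoPoly_eval]
  have hi2 : Set.EqOn (fun s => heaviside (t - s) * orthoLegendre k t * orthoLegendre l s)
      (fun _ => 0) (Set.uIoo t 1) := by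
    intro s hs
    rw [Set.uIoo_of_le ht.2] at hs
    simp [heaviside, hs.1]
  have hi3 : ∫ s in t..1, heaviside (t - s) * orthoLegendre k t * orthoLegendre l s = 0 := by
    rw [intervalIntegral.integral_congr_uIoo hi2, intervalIntegral.integral_zero]
  have hi4 : IntervalIntegrable
      (fun s => heaviside (t - s) * orthoLegendre k t * orthoLegendre l s)
      MeasureTheory.volume (-1) t := by
    refine IntervalIntegrable.congr_uIoo (f := fun s => orthoLegendre k t * (orthoPoly l).eval s)
      ((continuous_const.mul (orthoPoly l).continuous).intervalIntegrable _ _) ?_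
    intro s hs
    rw [Set.uIoo_of_le ht.1] at hs
    simp [heaviside, hs.2.le, orthoPoly_eval]
  have hi5 : IntervalIntegrable
      (fun s => heaviside (t - s) * orthoLegendre k t * orthoLegendre l s)
      MeasureTheory.volume t 1 :=
    IntervalIntegrable.congr_uIoo (f := fun _ => (0 : ℝ))
      (continuous_const.intervalIntegrable _ _) hi2.symm
  change ∫ s in (-1 : ℝ)..1, heaviside (t - s) * orthoLegendre k t * orthoLegendre l s = _
  rw [← intervalIntegral.integral_add_adjacent_intervals hi4 hi5, hi1, hi3,
    intervalIntegral.integral_const_mul, integral_eval_eq_primitive, add_zero]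
  simp only [Polynomial.eval_mul, orthoPoly_eval]
  rw [mul_comm]

open Polynomial in
/-- The primitive of an orthonormal Legendre polynomial, by the Legendre equation. -/
theorem primitive_orthoPoly_eq {n : ℕ} (hn : n ≠ 0) :
    primitive (orthoPoly n) = C (-(Real.sqrt ((2 * (n : ℝ) + 1) / 2) / (n * (n + 1)))) *
      ((1 - X ^ 2) * derivative (legendre n)) := by
  symm
  apply eq_primitive
  · have hnn : (n : ℝ) * (n + 1) ≠ 0 := by positivity
    have ho := legendre_ode n
    obtain ⟨a, ha⟩ : ∃ a : ℝ, a = Real.sqrt ((2 * (n : ℝ) + 1) / 2) / (n * (n + 1)) := ⟨_, rfl⟩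
    have ha2 : Real.sqrt ((2 * (n : ℝ) + 1) / 2) = a * (n * (n + 1)) := by
      rw [ha, div_mul_cancel₀ _ hnn]
    rw [← ha, orthoPoly, ha2, C_mul]
    simp only [derivative_mul, derivative_sub, derivative_one, sq, derivative_X, derivative_C, C_neg,
      derivative_neg]
    linear_combination C a * ho
  · simp

theorem abs_primitive_orthoPoly_le {n : ℕ} (hn : n ≠ 0) {t : ℝ} (ht : t ∈ Set.Icc (-1 : ℝ) 1) :
    |(primitive (orthoPoly n)).eval t| ≤ 1 / Real.sqrt n := by
  have hn0 : (0 : ℝ) < n := by positivity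
  have h1 : 0 ≤ 1 - t ^ 2 := by nlinarith [ht.1, ht.2]
  have h2 : 1 - t ^ 2 ≤ 1 := by nlinarith [sq_nonneg t]
  have h3 := legendre_derivative_sq_le (n := n) ht
  rw [primitive_orthoPoly_eq hn]
  refine abs_le_of_sq_le_sq ?_ (by positivity)
  rw [div_pow, Real.sq_sqrt hn0.le, one_pow]
  simp only [Polynomial.eval_mul, Polynomial.eval_C, Polynomial.eval_sub, Polynomial.eval_one,
    Polynomial.eval_pow, Polynomial.eval_X]
  rw [mul_pow, neg_sq, div_pow, Real.sq_sqrt (by positivity)]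
  set D := (Polynomial.derivative (legendre n)).eval t
  have h4 : ((1 - t ^ 2) * D) ^ 2 ≤ n * (n + 1) := by
    calc ((1 - t ^ 2) * D) ^ 2 = (1 - t ^ 2) * ((1 - t ^ 2) * D ^ 2) := by ring
      _ ≤ 1 * ((1 - t ^ 2) * D ^ 2) := by gcongr
      _ ≤ _ := by linarith
  calc _ ≤ (2 * (n : ℝ) + 1) / 2 / (n * (n + 1)) ^ 2 * (n * (n + 1)) := by gcongr
    _ ≤ 1 / n := by
      rw [sq, ← div_div, div_mul_cancel₀ _ (by positivity), div_div,
        div_le_div_iff₀ (by positivity) hn0]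
      nlinarith

open Polynomial in
/-- Integration by parts for the coefficients `coeffInf j l`. -/
theorem coeffInf_eq_neg_integral {j : ℕ} (hj : j ≠ 0) (l : ℕ) :
    coeffInf j l = -∫ x in (-1 : ℝ)..1, (orthoPoly l * primitive (orthoPoly j)).eval x := by
  have hI := integral_eval_derivative
    (primitive (orthoPoly l) * primitive (orthoPoly j)) (-1) 1
  rw [derivative_mul, derivative_primitive, derivative_primitive, integral_eval_add] at hI
  have h1 : (primitive (orthoPoly j)).eval 1 = 0 := by rw [primitive_orthoPoly_eq hj]; simp
  simp only [eval_mul, h1, primitive_eval_neg_one, mul_zero, sub_self] at hI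
  rw [coeffInf_eq, orthoCoef]
  simp only [eval_mul]
  linarith

open Polynomial in
theorem orthoCoef_sum {ι : Type*} (s : Finset ι) (a : ι → ℝ) (f : ι → ℝ[X]) (k : ℕ) :
    orthoCoef (∑ l ∈ s, C (a l) * f l) k = ∑ l ∈ s, a l * orthoCoef (f l) k := by
  rw [orthoCoef, Finset.sum_mul, integral_eval_sum]
  simp only [mul_assoc, integral_eval_C_mul, orthoCoef]

/-- The first `M` Legendre coefficients of a polynomial, the last one replaced by zero. -/
noncomputable def coefVec (M : ℕ) (f : Polynomial ℝ) : Fin M → ℂ :=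
  fun k => if (k : ℕ) + 1 = M then 0 else ((orthoCoef f k : ℝ) : ℂ)

theorem coefVec_of_degree_lt {m : ℕ} {f : Polynomial ℝ} (hf : f.degree < m) (k : Fin (m + 1)) :
    coefVec (m + 1) f k = ((orthoCoef f k : ℝ) : ℂ) := by
  rw [coefVec]
  split_ifs with h
  · rw [orthoCoef_eq_zero (by rwa [show (k : ℕ) = m by omega]), Complex.ofReal_zero]
  · rfl

theorem degree_lt_succ_of_lt {m : ℕ} {f : Polynomial ℝ} (hf : f.degree < m) :
    f.degree < (m + 1 : ℕ) :=
  hf.trans (by exact_mod_cast Nat.lt_succ_self m)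

theorem coeffMatrix_mulVec_coefVec {m : ℕ} {f : Polynomial ℝ} (hf : f.degree < m) :
    (coeffMatrix (m + 1)).mulVec (coefVec (m + 1) f) = coefVec (m + 1) (primitive f) := by
  ext k
  rw [Matrix.mulVec, dotProduct]
  simp only [coefVec_of_degree_lt hf, coeffMatrix, Matrix.of_apply]
  rw [coefVec]
  split_ifs with h
  · simp
  · rw [Fin.sum_univ_eq_sum_range (fun l : ℕ => ((coeffInf k l : ℝ) : ℂ) * (orthoCoef f l : ℝ))]
    conv_rhs => rw [eq_sum_orthoCoef (degree_lt_succ_of_lt hf), primitive_sum, orthoCoef_sum]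
    push_cast
    refine Finset.sum_congr rfl fun l _ => ?_
    rw [coeffInf_eq, mul_comm]

theorem phi_dotProduct_coefVec {m : ℕ} {f : Polynomial ℝ} (hf : f.degree < m) (t : ℝ) :
    phi (m + 1) t ⬝ᵥ coefVec (m + 1) f = ((f.eval t : ℝ) : ℂ) := by
  rw [dotProduct]
  simp only [coefVec_of_degree_lt hf, phi]
  rw [Fin.sum_univ_eq_sum_range (fun l : ℕ => ((orthoLegendre l t : ℝ) : ℂ) * (orthoCoef f l : ℝ))]
  conv_rhs => rw [eq_sum_orthoCoef (degree_lt_succ_of_lt hf), Polynomial.eval_finsetSum]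
  push_cast
  refine Finset.sum_congr rfl fun l _ => ?_
  rw [Polynomial.eval_mul, Polynomial.eval_C, orthoPoly_eval]
  push_cast
  ring

theorem sum_norm_coefVec_sq_le {m : ℕ} {f : Polynomial ℝ} (hf : f.degree < (m + 1 : ℕ)) :
    ∑ k, ‖coefVec (m + 1) f k‖ ^ 2 ≤ ∫ x in (-1 : ℝ)..1, (f * f).eval x := by
  rw [integral_mul_eq_sum_orthoCoef hf, ← Fin.sum_univ_eq_sum_range (fun k : ℕ =>
    orthoCoef f k * orthoCoef f k)]
  refine Finset.sum_le_sum fun k _ => ?_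
  rw [coefVec]
  split_ifs
  · simpa using mul_self_nonneg _
  · rw [Complex.norm_real, Real.norm_eq_abs, sq_abs, sq]

/-- The polynomial `(t + 1) ^ j / j!`. -/
noncomputable def expPoly (j : ℕ) : Polynomial ℝ :=
  Polynomial.C (1 / (j.factorial : ℝ)) * (Polynomial.X + 1) ^ j

theorem expPoly_eval (j : ℕ) (t : ℝ) : (expPoly j).eval t = (t + 1) ^ j / j.factorial := by
  simp [expPoly]; ring

open Polynomial in
theorem degree_expPoly_lt {j m : ℕ} (h : j < m) : (expPoly j).degree < m := by
  refine lt_of_le_of_lt ?_ (by exact_mod_cast h : (j : WithBot ℕ) < m)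
  rw [expPoly, degree_C_mul (by positivity)]
  refine (degree_pow_le _ _).trans ?_
  have : (X + 1 : ℝ[X]).degree = 1 := by simpa using degree_X_add_C (1 : ℝ)
  rw [this]; simp

open Polynomial in
theorem primitive_expPoly (j : ℕ) : primitive (expPoly j) = expPoly (j + 1) := by
  symm
  apply eq_primitive
  · rw [expPoly, derivative_C_mul, derivative_pow, expPoly, Nat.factorial_succ]
    simp only [derivative_add, derivative_X, derivative_one, add_zero, mul_one]
    rw [← mul_assoc, ← C_mul]
    push_cast
    congr 2
    field_simp
  · simp [expPoly_eval]

theorem integral_expPoly_sq_le (j : ℕ) :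
    ∫ x in (-1 : ℝ)..1, (expPoly j * expPoly j).eval x ≤ 2 * (2 ^ j / (j.factorial : ℝ)) ^ 2 := by
  have h : ∫ x in (-1 : ℝ)..1, (expPoly j * expPoly j).eval x ≤
      ∫ _x in (-1 : ℝ)..1, (2 ^ j / (j.factorial : ℝ)) ^ 2 := by
    apply intervalIntegral.integral_mono_on (by norm_num)
      ((Polynomial.continuous _).intervalIntegrable _ _) (by simp)
    intro x hx
    rw [Polynomial.eval_mul, ← sq, expPoly_eval]
    have : 0 ≤ x + 1 := by linarith [hx.1]
    have : x + 1 ≤ 2 := by linarith [hx.2]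
    gcongr
  refine h.trans (le_of_eq ?_)
  rw [intervalIntegral.integral_const]
  norm_num

theorem e1Sqrt2_eq_coefVec {m : ℕ} (hm : 1 ≤ m) : e1Sqrt2 (m + 1) = coefVec (m + 1) (expPoly 0) := by
  ext k
  rw [coefVec_of_degree_lt (degree_expPoly_lt (by omega)), e1Sqrt2]
  have h2 : Real.sqrt (1 / 2) * Real.sqrt 2 = 1 := by
    rw [← Real.sqrt_mul (by norm_num)]; norm_num
  have h1 : expPoly 0 = Polynomial.C (Real.sqrt 2) * orthoPoly 0 := by
    simp only [expPoly, orthoPoly, legendre]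
    rw [← mul_assoc, ← Polynomial.C_mul, mul_comm (Real.sqrt 2)]
    simp at h2 ⊢
  rw [h1, orthoCoef, mul_assoc, integral_eval_C_mul, integral_orthoPoly_mul]
  simp only [eq_comm]
  split_ifs <;> simp

theorem coeffMatrix_pow_mulVec {m j : ℕ} (hm : 1 ≤ m) (hj : j ≤ m) :
    (coeffMatrix (m + 1) ^ j).mulVec (e1Sqrt2 (m + 1)) = coefVec (m + 1) (expPoly j) := by
  induction j with
  | zero => rw [pow_zero, Matrix.one_mulVec, e1Sqrt2_eq_coefVec hm]
  | succ j ih =>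
    rw [pow_succ', ← Matrix.mulVec_mulVec, ih (by omega),
      coeffMatrix_mulVec_coefVec (degree_expPoly_lt (by omega)), primitive_expPoly]

/-- The binomial expansion of `(λ V - c) ^ k 1` for the integration operator `V`. -/
noncomputable def gPoly (lam c : ℂ) (k : ℕ) (s : ℂ) : ℂ :=
  ∑ j ∈ Finset.range (k + 1), (lam ^ j * (-c) ^ (k - j) * (k.choose j : ℂ)) * (s ^ j / j.factorial)

theorem sub_smul_one_pow_mulVec {ι : Type*} [Fintype ι] [DecidableEq ι] (T : Matrix ι ι ℂ)
    (lam c : ℂ) (k : ℕ) (v : ι → ℂ) :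
    ((lam • T - c • (1 : Matrix ι ι ℂ)) ^ k).mulVec v =
      ∑ j ∈ Finset.range (k + 1), (lam ^ j * (-c) ^ (k - j) * (k.choose j : ℂ)) •
        (T ^ j).mulVec v := by
  have hc : Commute (lam • T) ((-c) • (1 : Matrix ι ι ℂ)) := (Commute.one_right _).smul_right _
  rw [sub_eq_add_neg, ← neg_smul, hc.add_pow, Matrix.sum_mulVec]
  refine Finset.sum_congr rfl fun j _ => ?_
  rw [smul_pow, smul_pow, one_pow, ← Matrix.smul_mulVec]
  congr 1
  rw [smul_mul_smul_comm, mul_one, ← nsmul_eq_mul', ← Nat.cast_smul_eq_nsmul ℂ, smul_smul]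
  congr 1
  ring

theorem phi_dotProduct_pow_mulVec {m k : ℕ} (hm : 1 ≤ m) (hk : k < m) (lam c : ℂ) (t : ℝ) :
    phi (m + 1) t ⬝ᵥ (((lam • coeffMatrix (m + 1) - c • 1) ^ k).mulVec (e1Sqrt2 (m + 1))) =
      gPoly lam c k ((t + 1 : ℝ) : ℂ) := by
  rw [sub_smul_one_pow_mulVec, dotProduct_sum, gPoly]
  refine Finset.sum_congr rfl fun j hj => ?_
  rw [Finset.mem_range] at hj
  rw [dotProduct_smul, coeffMatrix_pow_mulVec hm (by omega),
    phi_dotProduct_coefVec (degree_expPoly_lt (by omega)), expPoly_eval, smul_eq_mul]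
  push_cast
  rfl

theorem norm_toLp_coefVec_le {m j : ℕ} (hj : j ≤ m) :
    ‖WithLp.toLp 2 (coefVec (m + 1) (expPoly j))‖ ≤ Real.sqrt 2 * (2 ^ j / (j.factorial : ℝ)) := by
  rw [EuclideanSpace.norm_eq]
  have h := (sum_norm_coefVec_sq_le (m := m) (degree_expPoly_lt (by omega))).trans
    (integral_expPoly_sq_le j)
  refine (Real.sqrt_le_sqrt h).trans ?_
  rw [Real.sqrt_mul (by norm_num), Real.sqrt_sq (by positivity)]

theorem norm_toLp_phi_le (M : ℕ) {t : ℝ} (ht : t ∈ Set.Icc (-1 : ℝ) 1) :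
    ‖WithLp.toLp 2 (phi M t)‖ ≤ M / Real.sqrt 2 := by
  rw [EuclideanSpace.norm_eq]
  have h : ∑ k, ‖(WithLp.toLp 2 (phi M t)) k‖ ^ 2 ≤ (M / Real.sqrt 2) ^ 2 := by
    rw [div_pow, Real.sq_sqrt (by norm_num)]
    refine le_trans (le_of_eq ?_) (sum_orthoLegendre_sq_le M ht)
    rw [← Fin.sum_univ_eq_sum_range (fun k : ℕ => orthoLegendre k t ^ 2)]
    refine Finset.sum_congr rfl fun k _ => ?_
    simp [phi]
  exact (Real.sqrt_le_sqrt h).trans (le_of_eq (Real.sqrt_sq (by positivity)))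

/-- A bound for the absolute binomial expansion. -/
theorem sum_choose_div_factorial_le (k : ℕ) {a : ℝ} (ha : 0 ≤ a) :
    ∑ j ∈ Finset.range (k + 1), (k.choose j : ℝ) * a ^ j / j.factorial ≤
      Real.exp (Real.sqrt (4 * k * a)) := by
  set y := Real.sqrt (k * a) with hy
  have hy0 : 0 ≤ y := Real.sqrt_nonneg _
  have hs : Real.sqrt (4 * k * a) = y + y := by
    rw [mul_assoc, Real.sqrt_mul (by norm_num), show (4 : ℝ) = 2 ^ 2 by norm_num,
      Real.sqrt_sq (by norm_num)]
    ring
  have h1 : ∀ j ∈ Finset.range (k + 1), (k.choose j : ℝ) * a ^ j / j.factorial ≤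
      (y ^ j / j.factorial) * (y ^ j / j.factorial) := by
    intro j _
    have h2 : (k.choose j : ℝ) ≤ k ^ j / j.factorial := Nat.choose_le_pow_div j k
    calc (k.choose j : ℝ) * a ^ j / j.factorial
        ≤ (k ^ j / j.factorial) * a ^ j / j.factorial := by gcongr
      _ = (y ^ j / j.factorial) * (y ^ j / j.factorial) := by
        have : y ^ j * y ^ j = k ^ j * a ^ j := by
          rw [← mul_pow, Real.mul_self_sqrt (by positivity), mul_pow]
        rw [div_mul_div_comm, this]
        field_simp
  have h3 : ∀ j ∈ Finset.range (k + 1), (y ^ j / j.factorial) * (y ^ j / j.factorial) ≤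
      (∑ i ∈ Finset.range (k + 1), y ^ i / i.factorial) * (y ^ j / j.factorial) := by
    intro j hj
    gcongr
    exact Finset.single_le_sum (f := fun i : ℕ => y ^ i / (i.factorial : ℝ))
      (fun i _ => by positivity) hj
  rw [hs, Real.exp_add]
  have he := Real.sum_le_exp_of_nonneg hy0 (k + 1)
  calc _ ≤ _ := Finset.sum_le_sum h1
    _ ≤ _ := Finset.sum_le_sum h3
    _ = (∑ i ∈ Finset.range (k + 1), y ^ i / i.factorial) *
        (∑ i ∈ Finset.range (k + 1), y ^ i / i.factorial) := by rw [Finset.mul_sum]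
    _ ≤ _ := by gcongr

theorem hasSum_gPoly (lam c s : ℂ) (hc : ‖c‖ < ‖1 - c‖) :
    HasSum (fun k : ℕ => gPoly lam c k s / (1 - c) ^ (k + 1)) (Complex.exp (lam * s)) := by
  have h1c : 0 < ‖1 - c‖ := (norm_nonneg c).trans_lt hc
  have h1c0 : 1 - c ≠ 0 := norm_pos_iff.mp h1c
  set r : ℂ := -c / (1 - c) with hr
  have hrn : ‖r‖ < 1 := by
    rw [hr, norm_div, norm_neg, div_lt_one h1c]; exact hc
  have h1r : 1 - r = 1 / (1 - c) := by rw [hr]; field_simp; ring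
  set F : ℕ × ℕ → ℂ := fun p => ((lam * s) ^ p.1 / p.1.factorial / (1 - c) ^ (p.1 + 1)) *
    (((p.2 + p.1).choose p.1 : ℂ) * r ^ p.2) with hF
  have hin : ∀ j, HasSum (fun i => F (j, i)) ((lam * s) ^ j / j.factorial) := by
    intro j
    have h := (hasSum_choose_mul_geometric_of_norm_lt_one j hrn).mul_left
      ((lam * s) ^ j / j.factorial / (1 - c) ^ (j + 1))
    rw [h1r, one_div_pow, one_div_one_div, div_mul_cancel₀ _ (pow_ne_zero _ h1c0)] at h
    exact h
  have hsum : Summable F := by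
    apply Summable.of_norm
    have hrn' : ‖(‖r‖ : ℝ)‖ < 1 := by simpa using hrn
    have hin' : ∀ j, HasSum (fun i => ‖F (j, i)‖)
        ((‖lam * s‖ ^ j / j.factorial / ‖1 - c‖ ^ (j + 1)) * (1 / (1 - ‖r‖) ^ (j + 1))) := by
      intro j
      have h := (hasSum_choose_mul_geometric_of_norm_lt_one j hrn').mul_left
        (‖lam * s‖ ^ j / j.factorial / ‖1 - c‖ ^ (j + 1))
      refine h.congr_fun fun i => ?_
      simp [hF]
    rw [summable_prod_of_nonneg (fun _ => norm_nonneg _)]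
    refine ⟨fun j => (hin' j).summable, ?_⟩
    simp only [(hin' _).tsum_eq]
    have h := (Real.summable_pow_div_factorial (‖lam * s‖ / (‖1 - c‖ * (1 - ‖r‖)))).mul_left
      (1 / (‖1 - c‖ * (1 - ‖r‖)))
    refine h.congr fun j => ?_
    have : 0 < 1 - ‖r‖ := by linarith
    rw [div_pow, mul_pow, pow_succ, pow_succ]
    field_simp
  have hexp : HasSum F (Complex.exp (lam * s)) := by
    have h1 := hsum.hasSum.prod_fiberwise hin
    have h2 := NormedSpace.expSeries_div_hasSum_exp (lam * s)
    rw [← Complex.exp_eq_exp_ℂ] at h2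
    rw [h2.unique h1]
    exact hsum.hasSum
  have h3 := (Finset.HasAntidiagonal.sigmaAntidiagonalEquivProd.hasSum_iff.mpr hexp).sigma
    (fun n => hasSum_fintype _)
  convert h3 using 1
  funext k
  change _ = ∑ b : Finset.HasAntidiagonal.antidiagonal k, F b.1
  rw [Finset.sum_coe_sort (Finset.HasAntidiagonal.antidiagonal k) F, Finset.Nat.sum_antidiagonal_eq_sum_range_succ_mk,
    gPoly, Finset.sum_div]
  refine Finset.sum_congr rfl fun j hj => ?_
  have hjk : j ≤ k := Nat.lt_succ_iff.mp (Finset.mem_range.mp hj)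
  simp only [hF, hr]
  rw [Nat.sub_add_cancel hjk, div_pow, mul_pow]
  have e : (1 - c) ^ (k + 1) = (1 - c) ^ (j + 1) * (1 - c) ^ (k - j) := by
    rw [← pow_add]; congr 1; omega
  rw [e]
  field_simp

/-- The sum of the absolute values in the binomial expansion. -/
theorem sum_abs_binomial_le {lam c : ℂ} {ρ : ℝ} (hc : c ≠ 0) (hl : ‖lam‖ ≤ ρ) {m k : ℕ}
    (hm : 1 ≤ m) (hk : m ≤ k) :
    ∑ j ∈ Finset.range (k + 1),
      ‖lam ^ j * (-c) ^ (k - j) * (k.choose j : ℂ)‖ * (2 ^ j / (j.factorial : ℝ)) ≤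
      (‖c‖ * Real.exp (Real.sqrt (9 * ρ / (m * ‖c‖)))) ^ k := by
  have hc0 : 0 < ‖c‖ := norm_pos_iff.mpr hc
  have hρ : 0 ≤ ρ := (norm_nonneg _).trans hl
  have hm0 : (0 : ℝ) < m := by exact_mod_cast hm
  have hmk : (m : ℝ) ≤ k := by exact_mod_cast hk
  have h1 : ∀ j ∈ Finset.range (k + 1),
      ‖lam ^ j * (-c) ^ (k - j) * (k.choose j : ℂ)‖ * (2 ^ j / (j.factorial : ℝ)) ≤
      ‖c‖ ^ k * ((k.choose j : ℝ) * (2 * ρ / ‖c‖) ^ j / j.factorial) := by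
    intro j hj
    have hjk : j ≤ k := Nat.lt_succ_iff.mp (Finset.mem_range.mp hj)
    rw [norm_mul, norm_mul, norm_pow, norm_pow, norm_neg, Complex.norm_natCast]
    have e : ‖c‖ ^ k = ‖c‖ ^ (k - j) * ‖c‖ ^ j := by rw [← pow_add]; congr 1; omega
    calc ‖lam‖ ^ j * ‖c‖ ^ (k - j) * (k.choose j : ℝ) * (2 ^ j / (j.factorial : ℝ))
        ≤ ρ ^ j * ‖c‖ ^ (k - j) * (k.choose j : ℝ) * (2 ^ j / (j.factorial : ℝ)) := by gcongr
      _ = _ := by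
        rw [e, div_pow, mul_pow]
        field_simp
  refine (Finset.sum_le_sum h1).trans ?_
  rw [← Finset.mul_sum, mul_pow, ← Real.exp_nat_mul]
  refine mul_le_mul_of_nonneg_left ?_ (by positivity)
  refine (sum_choose_div_factorial_le k (by positivity)).trans ?_
  refine Real.exp_le_exp.mpr ?_
  refine Real.sqrt_le_left (by positivity) |>.mpr ?_
  rw [mul_pow, Real.sq_sqrt (by positivity)]
  rw [show 4 * (k : ℝ) * (2 * ρ / ‖c‖) = 8 * ρ / ‖c‖ * k by ring,
    show (k : ℝ) ^ 2 * (9 * ρ / (m * ‖c‖)) = 9 * ρ / ‖c‖ * (k * (k / m)) by field_simp]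
  have h2 : 1 ≤ (k : ℝ) / m := by rwa [one_le_div hm0]
  have h3 : (k : ℝ) ≤ k * (k / m) := le_mul_of_one_le_right (by positivity) h2
  gcongr
  norm_num

theorem norm_gPoly_le {lam c : ℂ} {ρ : ℝ} (hc : c ≠ 0) (hl : ‖lam‖ ≤ ρ) {m k : ℕ}
    (hm : 1 ≤ m) (hk : m ≤ k) {s : ℂ} (hs : ‖s‖ ≤ 2) :
    ‖gPoly lam c k s‖ ≤ (‖c‖ * Real.exp (Real.sqrt (9 * ρ / (m * ‖c‖)))) ^ k := by
  refine le_trans ?_ (sum_abs_binomial_le hc hl hm hk)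
  refine (norm_sum_le _ _).trans (Finset.sum_le_sum fun j _ => ?_)
  rw [norm_mul, norm_div, norm_pow s, Complex.norm_natCast]
  gcongr

theorem norm_pow_mulVec_e1Sqrt2_le {lam c : ℂ} {ρ : ℝ} (hc : c ≠ 0) (hl : ‖lam‖ ≤ ρ) {m : ℕ}
    (hm : 1 ≤ m) :
    ‖WithLp.toLp 2 (((lam • coeffMatrix (m + 1) - c • 1) ^ m).mulVec (e1Sqrt2 (m + 1)))‖ ≤
      Real.sqrt 2 * (‖c‖ * Real.exp (Real.sqrt (9 * ρ / (m * ‖c‖)))) ^ m := by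
  rw [sub_smul_one_pow_mulVec, WithLp.toLp_sum]
  refine (norm_sum_le _ _).trans ?_
  refine le_trans ?_ (mul_le_mul_of_nonneg_left (sum_abs_binomial_le hc hl hm le_rfl)
    (Real.sqrt_nonneg 2))
  rw [Finset.mul_sum]
  refine Finset.sum_le_sum fun j hj => ?_
  have hjm : j ≤ m := Nat.lt_succ_iff.mp (Finset.mem_range.mp hj)
  rw [coeffMatrix_pow_mulVec hm hjm, WithLp.toLp_smul, norm_smul, mul_left_comm]
  exact mul_le_mul_of_nonneg_left (norm_toLp_coefVec_le hjm) (norm_nonneg _)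

theorem exp_sub_sum_gPoly_le {lam c : ℂ} {ρ : ℝ} (hc : c ≠ 0) (hl : ‖lam‖ ≤ ρ) {m : ℕ}
    (hm : 1 ≤ m) (hlt : ‖c‖ * Real.exp (Real.sqrt (9 * ρ / (m * ‖c‖))) < ‖1 - c‖)
    {s : ℂ} (hs : ‖s‖ ≤ 2) :
    ‖Complex.exp (lam * s) - ∑ k ∈ Finset.range m, gPoly lam c k s / (1 - c) ^ (k + 1)‖ ≤
      (‖c‖ * Real.exp (Real.sqrt (9 * ρ / (m * ‖c‖))) / ‖1 - c‖) ^ m /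
        (‖1 - c‖ - ‖c‖ * Real.exp (Real.sqrt (9 * ρ / (m * ‖c‖)))) := by
  set b := ‖c‖ * Real.exp (Real.sqrt (9 * ρ / (m * ‖c‖))) with hb
  have hb0 : 0 ≤ b := by positivity
  have h1c : 0 < ‖1 - c‖ := hb0.trans_lt hlt
  have hcb : ‖c‖ ≤ b := le_mul_of_one_le_right (norm_nonneg _)
    (Real.one_le_exp (Real.sqrt_nonneg _))
  have h := hasSum_gPoly lam c s (hcb.trans_lt hlt)
  have h2 := (hasSum_nat_add_iff' m).mpr h
  rw [← h2.tsum_eq]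
  have hq : b / ‖1 - c‖ < 1 := by rwa [div_lt_one h1c]
  have hg := (hasSum_geometric_of_lt_one (by positivity) hq).mul_left
    ((b / ‖1 - c‖) ^ m / ‖1 - c‖)
  have e : (b / ‖1 - c‖) ^ m / ‖1 - c‖ * (1 - b / ‖1 - c‖)⁻¹ =
      (b / ‖1 - c‖) ^ m / (‖1 - c‖ - b) := by
    rw [div_mul_eq_mul_div, mul_div_assoc]
    have : ‖1 - c‖ - b ≠ 0 := by linarith
    have h5 : 1 - b / ‖1 - c‖ = (‖1 - c‖ - b) / ‖1 - c‖ := by field_simp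
    rw [h5]
    field_simp
  rw [e] at hg
  refine tsum_of_norm_bounded hg fun k => ?_
  rw [norm_div, norm_pow]
  calc ‖gPoly lam c (k + m) s‖ / ‖1 - c‖ ^ (k + m + 1)
      ≤ b ^ (k + m) / ‖1 - c‖ ^ (k + m + 1) := by
        gcongr
        exact norm_gPoly_le hc hl hm (by omega) hs
    _ = _ := by
      rw [div_pow, div_pow, pow_succ, pow_add, pow_add]
      field_simp

theorem mul_geom_resolvent {ι : Type*} [Fintype ι] [DecidableEq ι] (B : Matrix ι ι ℂ) {c : ℂ}
    (hc : c ≠ 1) (n : ℕ) :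
    (1 - B) * ∑ k ∈ Finset.range n, ((1 - c) ^ (k + 1))⁻¹ • (B - c • (1 : Matrix ι ι ℂ)) ^ k =
      1 - ((1 - c) ^ n)⁻¹ • (B - c • (1 : Matrix ι ι ℂ)) ^ n := by
  have h1 : (1 - c) ≠ 0 := sub_ne_zero.mpr hc.symm
  have e : 1 - B = (1 - c) • (1 : Matrix ι ι ℂ) - (B - c • 1) := by rw [sub_smul, one_smul]; abel
  induction n with
  | zero => simp
  | succ n ih =>
    rw [Finset.sum_range_succ, mul_add, ih]
    conv_lhs => rw [e]
    rw [sub_mul, smul_mul_assoc, one_mul, mul_smul_comm, ← pow_succ', smul_smul]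
    have : (1 - c) * ((1 - c) ^ (n + 1))⁻¹ = ((1 - c) ^ n)⁻¹ := by
      rw [pow_succ]; field_simp
    rw [this]
    abel

/-- The error bound for one eigenvalue. -/
theorem norm_exp_sub_resolvent_le {lam c : ℂ} {ρ : ℝ} (hc : c ≠ 0) (hl : ‖lam‖ ≤ ρ) {m : ℕ}
    (hm : 1 ≤ m) (hlt : ‖c‖ * Real.exp (Real.sqrt (9 * ρ / (m * ‖c‖))) < ‖1 - c‖)
    {t : ℝ} (ht : t ∈ Set.Icc (-1 : ℝ) 1) (R : Matrix (Fin (m + 1)) (Fin (m + 1)) ℂ)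
    (hR : R * (1 - lam • coeffMatrix (m + 1)) = 1) (H : ℝ)
    (hH0 : 0 ≤ H) (hH : ∀ y : Fin (m + 1) → ℂ, ‖WithLp.toLp 2 (R.mulVec y)‖ ≤ H * ‖WithLp.toLp 2 y‖) :
    ‖Complex.exp (lam * ((t + 1 : ℝ) : ℂ)) - phi (m + 1) t ⬝ᵥ R.mulVec (e1Sqrt2 (m + 1))‖ ≤
      (1 / (‖1 - c‖ - ‖c‖ * Real.exp (Real.sqrt (9 * ρ / (m * ‖c‖)))) + (m + 1 : ℕ) * H) *
        (‖c‖ * Real.exp (Real.sqrt (9 * ρ / (m * ‖c‖))) / ‖1 - c‖) ^ m := by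
  have hs : ‖((t + 1 : ℝ) : ℂ)‖ ≤ 2 := by
    rw [Complex.norm_real, Real.norm_eq_abs, abs_le]
    constructor <;> linarith [ht.1, ht.2]
  have hA := exp_sub_sum_gPoly_le hc hl hm hlt hs
  have hB := norm_pow_mulVec_e1Sqrt2_le hc hl hm
  set b := ‖c‖ * Real.exp (Real.sqrt (9 * ρ / (m * ‖c‖))) with hb
  have hb0 : 0 ≤ b := by positivity
  have h1c : 0 < ‖1 - c‖ := hb0.trans_lt hlt
  have hc1 : c ≠ 1 := by rintro rfl; simp at h1c
  set B := lam • coeffMatrix (m + 1) with hBdef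
  set w := ((B - c • (1 : Matrix _ _ ℂ)) ^ m).mulVec (e1Sqrt2 (m + 1)) with hw
  have hg := congrArg (fun X => R * X) (mul_geom_resolvent B hc1 m)
  simp only [← mul_assoc, hR, one_mul, mul_sub, mul_one, mul_smul_comm] at hg
  have hRv : phi (m + 1) t ⬝ᵥ R.mulVec (e1Sqrt2 (m + 1)) =
      ∑ k ∈ Finset.range m, gPoly lam c k ((t + 1 : ℝ) : ℂ) / (1 - c) ^ (k + 1) +
        ((1 - c) ^ m)⁻¹ * (phi (m + 1) t ⬝ᵥ R.mulVec w) := by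
    have h1 : R = ∑ k ∈ Finset.range m, ((1 - c) ^ (k + 1))⁻¹ • (B - c • 1) ^ k +
        ((1 - c) ^ m)⁻¹ • (R * (B - c • 1) ^ m) := by rw [hg]; abel
    conv_lhs => rw [h1]
    rw [Matrix.add_mulVec, Matrix.sum_mulVec, dotProduct_add, dotProduct_sum, Matrix.smul_mulVec,
      dotProduct_smul, ← Matrix.mulVec_mulVec, smul_eq_mul]
    congr 1
    refine Finset.sum_congr rfl fun k hk => ?_
    rw [Matrix.smul_mulVec, dotProduct_smul,
      phi_dotProduct_pow_mulVec hm (Finset.mem_range.mp hk), smul_eq_mul, div_eq_inv_mul]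
  have hdot : ‖phi (m + 1) t ⬝ᵥ R.mulVec w‖ ≤ (m + 1 : ℕ) * H * b ^ m := by
    have h1 : ‖phi (m + 1) t ⬝ᵥ R.mulVec w‖ ≤
        ‖WithLp.toLp 2 (phi (m + 1) t)‖ * ‖WithLp.toLp 2 (R.mulVec w)‖ := by
      have he : inner ℂ (WithLp.toLp 2 (phi (m + 1) t)) (WithLp.toLp 2 (R.mulVec w)) =
          phi (m + 1) t ⬝ᵥ R.mulVec w := by
        rw [EuclideanSpace.inner_toLp_toLp, dotProduct_comm]
        congr 1
        ext k
        simp [phi]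
      rw [← he]
      exact norm_inner_le_norm _ _
    have hw0 : H * ‖WithLp.toLp 2 w‖ ≤ H * (Real.sqrt 2 * b ^ m) :=
      mul_le_mul_of_nonneg_left hB hH0
    calc _ ≤ _ := h1
      _ ≤ ((m + 1 : ℕ) / Real.sqrt 2) * (H * (Real.sqrt 2 * b ^ m)) :=
        mul_le_mul (norm_toLp_phi_le _ ht) ((hH w).trans hw0) (norm_nonneg _) (by positivity)
      _ = _ := by field_simp
  rw [hRv, ← sub_sub]
  refine (norm_sub_le _ _).trans ?_
  rw [add_mul]
  refine add_le_add (hA.trans (le_of_eq (by ring))) ?_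
  rw [norm_mul, norm_inv, norm_pow, div_pow]
  calc _ ≤ (‖1 - c‖ ^ m)⁻¹ * ((m + 1 : ℕ) * H * b ^ m) := by gcongr
    _ = _ := by ring

section Embedding

variable {N M : ℕ}

/-- The basis vector of `Ell2 N` attached to an index of a truncated matrix. -/
noncomputable def truncVec (p : Fin N × Fin M) : Ell2 N := stdVec (p.1, (p.2 : ℕ))

theorem orthonormal_truncVec : Orthonormal ℂ (truncVec : Fin N × Fin M → Ell2 N) := by
  rw [orthonormal_iff_ite]
  intro p q
  rw [truncVec, truncVec, inner_stdVec]
  simp [Prod.ext_iff, Fin.ext_iff]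

/-- The isometric embedding of `ℂ^N ⊗ ℂ^M` into `ℂ^N ⊗ ℓ²`. -/
noncomputable def embed (x : Fin N × Fin M → ℂ) : Ell2 N := ∑ p, x p • truncVec p

theorem inner_truncVec_embed (x : Fin N × Fin M → ℂ) (p : Fin N × Fin M) :
    inner ℂ (truncVec p) (embed x) = x p :=
  orthonormal_truncVec.inner_right_fintype x p

theorem norm_embed (x : Fin N × Fin M → ℂ) : ‖embed x‖ = ‖WithLp.toLp 2 x‖ := by
  have h1 : inner ℂ (embed x) (embed x) = ∑ p, (starRingEnd ℂ) (x p) * x p := by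
    rw [embed, orthonormal_truncVec.inner_sum]
  rw [inner_self_eq_norm_sq_to_K] at h1
  have h2 : ‖embed x‖ ^ 2 = ∑ p, ‖x p‖ ^ 2 := by
    have : ((‖embed x‖ ^ 2 : ℝ) : ℂ) = ((∑ p, ‖x p‖ ^ 2 : ℝ) : ℂ) := by
      push_cast
      refine h1.trans (Finset.sum_congr rfl fun p _ => ?_)
      rw [RCLike.conj_mul]
      rfl
    exact_mod_cast this
  rw [EuclideanSpace.norm_eq, ← Real.sqrt_sq (norm_nonneg (embed x)), h2]

/-- The bounded operator on `Ell2 N` given by a finite matrix, extended by zero. -/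
noncomputable def extendOp (B : Matrix (Fin N × Fin M) (Fin N × Fin M) ℂ) :
    Ell2 N →L[ℂ] Ell2 N :=
  ∑ p, ∑ q, B p q • InnerProductSpace.rankOne ℂ (truncVec p) (truncVec q)

theorem extendOp_apply (B : Matrix (Fin N × Fin M) (Fin N × Fin M) ℂ) (v : Ell2 N) :
    extendOp B v = embed (B.mulVec fun q => inner ℂ (truncVec q) v) := by
  simp only [extendOp, embed, sum_apply, smul_apply, InnerProductSpace.rankOne_apply,
    Matrix.mulVec, dotProduct, Finset.sum_smul, smul_smul]

theorem extendOp_embed (B : Matrix (Fin N × Fin M) (Fin N × Fin M) ℂ) (x : Fin N × Fin M → ℂ) :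
    extendOp B (embed x) = embed (B.mulVec x) := by
  simp only [extendOp_apply, inner_truncVec_embed]

theorem extendOp_mul (B C : Matrix (Fin N × Fin M) (Fin N × Fin M) ℂ) :
    extendOp B * extendOp C = extendOp (B * C) := by
  ext1 v
  rw [mul_apply_eq_comp, extendOp_apply C, extendOp_embed, extendOp_apply,
    Matrix.mulVec_mulVec]

theorem extendOp_add (B C : Matrix (Fin N × Fin M) (Fin N × Fin M) ℂ) :
    extendOp (B + C) = extendOp B + extendOp C := by
  simp only [extendOp, Matrix.add_apply, add_smul, Finset.sum_add_distrib]

theorem norm_extendOp_le (B : Matrix (Fin N × Fin M) (Fin N × Fin M) ℂ) :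
    ‖extendOp B‖ ≤ ∑ p, ∑ q, ‖B p q‖ := by
  have hn : ∀ p : Fin N × Fin M, ‖truncVec p‖ = 1 := orthonormal_truncVec.1
  refine (norm_sum_le _ _).trans (Finset.sum_le_sum fun p _ => ?_)
  refine (norm_sum_le _ _).trans (Finset.sum_le_sum fun q _ => ?_)
  rw [norm_smul, InnerProductSpace.norm_rankOne, hn, hn, mul_one, mul_one]

theorem kronHat_eq_extendOp (A : Matrix (Fin N) (Fin N) ℂ) :
    kronHat A M = extendOp (A ⊗ₖ coeffMatrix M) := by
  simp only [kronHat, extendOp, Fintype.sum_prod_type, truncVec, Matrix.kronecker_apply]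
  refine Finset.sum_congr rfl fun i _ => ?_
  rw [Finset.sum_comm' (t' := Finset.range M) (s' := fun _ => Finset.univ) (by simp)]
  rw [← Fin.sum_univ_eq_sum_range (fun k => ∑ j : Fin N, ∑ l ∈ Finset.range M,
    (A i j * ((coeffHat M k l : ℝ) : ℂ)) •
      InnerProductSpace.rankOne ℂ (stdVec (i, k)) (stdVec (j, l)))]
  refine Finset.sum_congr rfl fun k _ => Finset.sum_congr rfl fun j _ => ?_
  rw [← Fin.sum_univ_eq_sum_range (fun l =>
    (A i j * ((coeffHat M k l : ℝ) : ℂ)) •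
      InnerProductSpace.rankOne ℂ (stdVec (i, (k : ℕ))) (stdVec (j, l)))]
  refine Finset.sum_congr rfl fun l _ => ?_
  congr 2
  have hk := k.2
  have hl := l.2
  by_cases h : (k : ℕ) + 1 = M
  · simp [coeffMatrix, coeffHat, h]
  · have h' : (k : ℕ) + 1 < M := by omega
    simp [coeffMatrix, coeffHat, h, h', hl]

theorem one_sub_extendOp_mul {B X : Matrix (Fin N × Fin M) (Fin N × Fin M) ℂ}
    (h : (1 - B) * X = 1) : (1 - extendOp B) * (1 + extendOp (X - 1)) = 1 := by
  have e : X - 1 = B + B * (X - 1) := by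
    rw [sub_mul, one_mul] at h
    rw [mul_sub, mul_one, ← h]
    abel
  have h2 : extendOp (X - 1) = extendOp B + extendOp B * extendOp (X - 1) := by
    rw [extendOp_mul, ← extendOp_add, ← e]
  rw [sub_mul, one_mul, mul_add, mul_one]
  nth_rewrite 1 [h2]
  abel

theorem mul_one_sub_extendOp {B X : Matrix (Fin N × Fin M) (Fin N × Fin M) ℂ}
    (h : X * (1 - B) = 1) : (1 + extendOp (X - 1)) * (1 - extendOp B) = 1 := by
  have e : X - 1 = B + (X - 1) * B := by
    rw [mul_sub, mul_one] at h
    rw [sub_mul, one_mul, ← h]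
    abel
  have h2 : extendOp (X - 1) = extendOp B + extendOp (X - 1) * extendOp B := by
    rw [extendOp_mul, ← extendOp_add, ← e]
  rw [mul_sub, mul_one, add_mul, one_mul]
  nth_rewrite 1 [h2]
  abel

theorem inverse_one_sub_extendOp {B X : Matrix (Fin N × Fin M) (Fin N × Fin M) ℂ}
    (h : (1 - B) * X = 1) : Ring.inverse (1 - extendOp B) = 1 + extendOp (X - 1) :=
  Ring.inverse_unit (⟨_, _, one_sub_extendOp_mul h, mul_one_sub_extendOp (mul_eq_one_comm.mp h)⟩ :
    (Ell2 N →L[ℂ] Ell2 N)ˣ)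

/-- The Kronecker product of two vectors. -/
def kronVec (v : Fin N → ℂ) (x : Fin M → ℂ) : Fin N × Fin M → ℂ := fun p => v p.1 * x p.2

theorem kronecker_mulVec_kronVec (A : Matrix (Fin N) (Fin N) ℂ) (T : Matrix (Fin M) (Fin M) ℂ)
    (v : Fin N → ℂ) (x : Fin M → ℂ) :
    (A ⊗ₖ T).mulVec (kronVec v x) = kronVec (A.mulVec v) (T.mulVec x) := by
  ext ⟨a, b⟩
  simp only [Matrix.mulVec, dotProduct, kronVec, Fintype.sum_prod_type, Matrix.kronecker_apply,
    Finset.sum_mul_sum]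
  refine Finset.sum_congr rfl fun i _ => Finset.sum_congr rfl fun k _ => ?_
  ring

theorem one_sub_kronecker_mulVec {A : Matrix (Fin N) (Fin N) ℂ} {v : Fin N → ℂ} {lam : ℂ}
    (hv : A.mulVec v = lam • v) (T : Matrix (Fin M) (Fin M) ℂ) (x : Fin M → ℂ) :
    (1 - A ⊗ₖ T).mulVec (kronVec v x) = kronVec v ((1 - lam • T).mulVec x) := by
  rw [Matrix.sub_mulVec, Matrix.one_mulVec, kronecker_mulVec_kronVec, hv, Matrix.sub_mulVec,
    Matrix.one_mulVec, Matrix.smul_mulVec]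
  ext p
  simp only [kronVec, Pi.sub_apply, Pi.smul_apply, smul_eq_mul]
  ring

theorem norm_kronVec (v : Fin N → ℂ) (x : Fin M → ℂ) :
    ‖WithLp.toLp 2 (kronVec v x)‖ = ‖WithLp.toLp 2 v‖ * ‖WithLp.toLp 2 x‖ := by
  rw [EuclideanSpace.norm_eq, EuclideanSpace.norm_eq, EuclideanSpace.norm_eq,
    ← Real.sqrt_mul (Finset.sum_nonneg fun _ _ => by positivity), Finset.sum_mul_sum,
    Fintype.sum_prod_type]
  simp only [kronVec, norm_mul, mul_pow]

theorem isUnit_one_sub_smul {A : Matrix (Fin N) (Fin N) ℂ} {v : Fin N → ℂ} {lam : ℂ}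
    (hv : A.mulVec v = lam • v) (hv0 : v ≠ 0) {T : Matrix (Fin M) (Fin M) ℂ}
    {X : Matrix (Fin N × Fin M) (Fin N × Fin M) ℂ} (hX : X * (1 - A ⊗ₖ T) = 1) :
    IsUnit (1 - lam • T) := by
  rw [Matrix.isUnit_iff_isUnit_det, isUnit_iff_ne_zero]
  intro hdet
  obtain ⟨x, hx0, hx⟩ := Matrix.exists_mulVec_eq_zero_iff.mpr hdet
  have h := one_sub_kronecker_mulVec hv T x
  rw [hx] at h
  have h2 : kronVec v x = 0 := by
    have h3 := congrArg X.mulVec h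
    rw [Matrix.mulVec_mulVec, hX, Matrix.one_mulVec] at h3
    rw [h3]
    have : kronVec v (0 : Fin M → ℂ) = 0 := by ext p; simp [kronVec]
    rw [this, Matrix.mulVec_zero]
  obtain ⟨i, hi⟩ := Function.ne_iff.mp hv0
  obtain ⟨k, hk⟩ := Function.ne_iff.mp hx0
  exact mul_ne_zero hi hk (congrFun h2 (i, k))

theorem norm_resolvent_mulVec_le {A : Matrix (Fin N) (Fin N) ℂ} {v : Fin N → ℂ} {lam : ℂ}
    (hv : A.mulVec v = lam • v) (hv0 : v ≠ 0)
    {X : Matrix (Fin N × Fin M) (Fin N × Fin M) ℂ} (hX : (1 - A ⊗ₖ coeffMatrix M) * X = 1)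
    {R : Matrix (Fin M) (Fin M) ℂ} (hR : (1 - lam • coeffMatrix M) * R = 1) (y : Fin M → ℂ) :
    ‖WithLp.toLp 2 (R.mulVec y)‖ ≤
      ‖Ring.inverse (1 - kronHat A M)‖ * ‖WithLp.toLp 2 y‖ := by
  have h1 : (1 - kronHat A M) (embed (kronVec v (R.mulVec y))) = embed (kronVec v y) := by
    have h := one_sub_kronecker_mulVec hv (coeffMatrix M) (R.mulVec y)
    rw [Matrix.mulVec_mulVec, hR, Matrix.one_mulVec, Matrix.sub_mulVec, Matrix.one_mulVec] at h
    rw [← h, kronHat_eq_extendOp, sub_apply, extendOp_embed]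
    simp only [embed, Pi.sub_apply, sub_smul, Finset.sum_sub_distrib]
    rfl
  have h2 : Ring.inverse (1 - kronHat A M) * (1 - kronHat A M) = 1 := by
    rw [kronHat_eq_extendOp, inverse_one_sub_extendOp hX]
    exact mul_one_sub_extendOp (mul_eq_one_comm.mp hX)
  have h3 : embed (kronVec v (R.mulVec y)) =
      Ring.inverse (1 - kronHat A M) (embed (kronVec v y)) := by
    rw [← h1, ← mul_apply_eq_comp, h2]
    rfl
  have h4 := (Ring.inverse (1 - kronHat A M)).le_opNorm (embed (kronVec v y))
  rw [← h3, norm_embed, norm_embed, norm_kronVec, norm_kronVec, mul_left_comm] at h4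
  refine le_of_mul_le_mul_left h4 (norm_pos_iff.mpr ?_)
  intro h
  exact hv0 (by simpa using h)

end Embedding

section Diagonalization

variable {N M : ℕ} {A Z : Matrix (Fin N) (Fin N) ℂ} {d : Fin N → ℂ}

theorem mulVec_col_eq (hZ : IsUnit Z) (hA : A = Z * Matrix.diagonal d * Z⁻¹) (m : Fin N) :
    A.mulVec (Z.col m) = d m • Z.col m := by
  have hdet := (Matrix.isUnit_iff_isUnit_det Z).mp hZ
  have e : A * Z = Z * Matrix.diagonal d := by
    rw [hA, mul_assoc, Matrix.nonsing_inv_mul _ hdet, mul_one]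
  ext i
  have := congrFun (congrFun e i) m
  rw [Matrix.mul_diagonal] at this
  rw [Pi.smul_apply, smul_eq_mul, mul_comm]
  exact this

theorem col_ne_zero_of_isUnit (hZ : IsUnit Z) (m : Fin N) : Z.col m ≠ 0 := by
  have hdet := (Matrix.isUnit_iff_isUnit_det Z).mp hZ
  intro h
  have e := congrFun (congrFun (Matrix.nonsing_inv_mul _ hdet) m) m
  have h2 : ∀ i, Z i m = 0 := fun i => congrFun h i
  simp [Matrix.mul_apply, h2] at e

theorem norm_le_rho (hZ : IsUnit Z) (hA : A = Z * Matrix.diagonal d * Z⁻¹) (m : Fin N) :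
    ‖d m‖ ≤ rho A := by
  have : Nonempty (Fin N) := ⟨m⟩
  have hmem : d m ∈ spectrum ℂ A := by
    rw [spectrum.mem_iff, Matrix.isUnit_iff_isUnit_det, isUnit_iff_ne_zero, not_not,
      ← Matrix.exists_mulVec_eq_zero_iff]
    refine ⟨Z.col m, col_ne_zero_of_isUnit hZ m, ?_⟩
    rw [Matrix.sub_mulVec, mulVec_col_eq hZ hA, Algebra.algebraMap_eq_smul_one,
      Matrix.smul_mulVec, Matrix.one_mulVec, sub_self]
  have h1 : (‖d m‖₊ : ENNReal) ≤ spectralRadius ℂ A :=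
    le_iSup₂ (f := fun (k : ℂ) (_ : k ∈ spectrum ℂ A) => (‖k‖₊ : ENNReal)) (d m) hmem
  have h2 : spectralRadius ℂ A ≠ ⊤ :=
    ((spectrum.spectralRadius_le_nnnorm A).trans_lt ENNReal.coe_lt_top).ne
  have h3 := ENNReal.toReal_mono h2 h1
  simpa [rho] using h3

/-- The spectral projections of a diagonalized matrix. -/
noncomputable def specProj (Z : Matrix (Fin N) (Fin N) ℂ) (m : Fin N) : Matrix (Fin N) (Fin N) ℂ :=
  Z * Matrix.diagonal (Pi.single m 1) * Z⁻¹

theorem sum_smul_specProj (Z : Matrix (Fin N) (Fin N) ℂ) (a : Fin N → ℂ) :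
    ∑ m, a m • specProj Z m = Z * Matrix.diagonal a * Z⁻¹ := by
  have h : Matrix.diagonal a = ∑ m, a m • Matrix.diagonal (Pi.single m (1 : ℂ)) := by
    ext i j
    rw [Matrix.sum_apply]
    by_cases hij : i = j
    · subst hij
      simp [Pi.single_apply]
    · simp [hij]
  rw [h, Finset.mul_sum, Finset.sum_mul]
  simp [specProj]

theorem mul_specProj (hZ : IsUnit Z) (hA : A = Z * Matrix.diagonal d * Z⁻¹) (m : Fin N) :
    A * specProj Z m = d m • specProj Z m := by
  have hdet := (Matrix.isUnit_iff_isUnit_det Z).mp hZ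
  have e : A * Z = Z * Matrix.diagonal d := by
    rw [hA, mul_assoc, Matrix.nonsing_inv_mul _ hdet, mul_one]
  have e2 : Matrix.diagonal d * Matrix.diagonal (Pi.single m (1 : ℂ)) =
      d m • Matrix.diagonal (Pi.single m (1 : ℂ)) := by
    rw [Matrix.diagonal_mul_diagonal, ← Matrix.diagonal_smul]
    congr 1
    ext i
    by_cases h : i = m
    · subst h; simp
    · simp [h]
  rw [specProj, ← mul_assoc, ← mul_assoc, e, mul_assoc Z, e2, mul_smul_comm, smul_mul_assoc]

theorem one_sub_kronecker_mul_sum (hZ : IsUnit Z) (hA : A = Z * Matrix.diagonal d * Z⁻¹)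
    {T : Matrix (Fin M) (Fin M) ℂ} {R : Fin N → Matrix (Fin M) (Fin M) ℂ}
    (hR : ∀ m, (1 - d m • T) * R m = 1) :
    (1 - A ⊗ₖ T) * ∑ m, specProj Z m ⊗ₖ R m = 1 := by
  have hdet := (Matrix.isUnit_iff_isUnit_det Z).mp hZ
  have h1 : ∀ m, (1 - A ⊗ₖ T) * (specProj Z m ⊗ₖ R m) = specProj Z m ⊗ₖ 1 := by
    intro m
    rw [← hR m, sub_mul, one_mul, ← Matrix.mul_kronecker_mul, mul_specProj hZ hA, sub_mul, one_mul,
      smul_mul_assoc, Matrix.smul_kronecker, ← Matrix.kronecker_smul, sub_eq_add_neg,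
      sub_eq_add_neg, Matrix.kronecker_add]
    congr 1
    ext p q
    simp
  have h2 : ∑ m, specProj Z m = 1 := by
    have := sum_smul_specProj Z (fun _ => 1)
    simpa [Matrix.mul_nonsing_inv _ hdet] using this
  rw [Finset.mul_sum]
  simp only [h1]
  have h3 : ∑ m, specProj Z m ⊗ₖ (1 : Matrix (Fin M) (Fin M) ℂ) = (∑ m, specProj Z m) ⊗ₖ 1 := by
    ext p q
    simp [Matrix.sum_apply, Finset.sum_mul]
  rw [h3, h2, Matrix.one_kronecker_one]

theorem starApprox_eq (hZ : IsUnit Z) (hA : A = Z * Matrix.diagonal d * Z⁻¹)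
    {R : Fin N → Matrix (Fin M) (Fin M) ℂ}
    (hR : ∀ m, (1 - d m • coeffMatrix M) * R m = 1) (t : ℝ) :
    starApprox A M t =
      Z * Matrix.diagonal (fun m => phi M t ⬝ᵥ (R m).mulVec (e1Sqrt2 M)) * Z⁻¹ := by
  rw [← sum_smul_specProj, starApprox,
    Matrix.inv_eq_right_inv (one_sub_kronecker_mul_sum hZ hA hR), Matrix.mul_sum, Matrix.sum_mul]
  simp only [← Matrix.mul_kronecker_mul, one_mul, mul_one]
  ext i j
  rw [Matrix.submatrix_apply, Matrix.sum_apply, Matrix.sum_apply]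
  refine Finset.sum_congr rfl fun m _ => ?_
  rw [Matrix.kronecker_apply, Matrix.smul_apply, smul_eq_mul, mul_comm]
  congr 1
  rw [Matrix.dotProduct_mulVec]
  rfl

theorem exp_smul_eq (hZ : IsUnit Z) (hA : A = Z * Matrix.diagonal d * Z⁻¹) (s : ℂ) :
    NormedSpace.exp (s • A) = Z * Matrix.diagonal (fun m => Complex.exp (d m * s)) * Z⁻¹ := by
  rw [hA, ← smul_mul_assoc, ← mul_smul_comm, ← Matrix.diagonal_smul, Matrix.exp_conj _ _ hZ,
    Matrix.exp_diagonal]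
  congr 3
  ext m
  rw [Pi.coe_exp, Complex.exp_eq_exp_ℂ, Pi.smul_apply, smul_eq_mul, mul_comm]

theorem norm_conj_diagonal_le (Z : Matrix (Fin N) (Fin N) ℂ) {a : Fin N → ℂ} {b : ℝ} (hb : 0 ≤ b)
    (h : ∀ m, ‖a m‖ ≤ b) : ‖Z * Matrix.diagonal a * Z⁻¹‖ ≤ kappa Z * b := by
  have h1 : ‖Matrix.diagonal a‖ ≤ b := by
    rw [Matrix.l2_opNorm_diagonal]
    exact (pi_norm_le_iff_of_nonneg hb).mpr h
  calc _ ≤ ‖Z‖ * ‖Matrix.diagonal a‖ * ‖Z⁻¹‖ :=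
        (norm_mul_le _ _).trans (by gcongr; exact norm_mul_le _ _)
    _ ≤ ‖Z‖ * b * ‖Z⁻¹‖ := by gcongr
    _ = _ := by rw [kappa]; ring

end Diagonalization

section Taylor

variable {ι : Type} [Fintype ι] [DecidableEq ι] {B : Matrix ι ι ℂ} {c : ℂ}

theorem HasTaylorExpansionAt.tendsto_term (h : HasTaylorExpansionAt B c) :
    Filter.Tendsto (fun n : ℕ => ((1 - c) ^ (n + 1))⁻¹ • (B - c • (1 : Matrix ι ι ℂ)) ^ n)
      Filter.atTop (nhds 0) := by
  have h1 := (h.2.comp (Filter.tendsto_add_atTop_nat 1)).sub h.2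
  rw [sub_self] at h1
  refine h1.congr fun n => ?_
  simp only [Function.comp, Finset.sum_range_succ, add_sub_cancel_left]

theorem HasTaylorExpansionAt.mul_inv_eq_one (h : HasTaylorExpansionAt B c) :
    (1 - B) * (1 - B)⁻¹ = 1 := by
  have h1 : Filter.Tendsto (fun n : ℕ => (1 - B) * ∑ k ∈ Finset.range n,
      ((1 - c) ^ (k + 1))⁻¹ • (B - c • (1 : Matrix ι ι ℂ)) ^ k) Filter.atTop
      (nhds ((1 - B) * (1 - B)⁻¹)) := h.2.const_mul (1 - B)
  have h2 : Filter.Tendsto (fun n : ℕ => (1 : Matrix ι ι ℂ) - (1 - c) •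
      (((1 - c) ^ (n + 1))⁻¹ • (B - c • (1 : Matrix ι ι ℂ)) ^ n)) Filter.atTop
      (nhds (1 - (1 - c) • 0)) := (h.tendsto_term.const_smul (1 - c)).const_sub 1
  rw [smul_zero, sub_zero] at h2
  refine tendsto_nhds_unique h1 (h2.congr fun n => ?_)
  have h3 : (1 - c) ≠ 0 := sub_ne_zero.mpr h.1.symm
  rw [mul_geom_resolvent B h.1, smul_smul, pow_succ, mul_inv, mul_comm (1 - c), mul_assoc,
    inv_mul_cancel₀ h3, mul_one]

theorem sub_smul_one_pow_row (p : ι) (hp : ∀ q, B p q = 0) (n : ℕ) (q : ι) :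
    ((B - c • (1 : Matrix ι ι ℂ)) ^ n) p q = (-c) ^ n * (1 : Matrix ι ι ℂ) p q := by
  induction n with
  | zero => simp
  | succ n ih =>
    rw [pow_succ', Matrix.mul_apply, Finset.sum_eq_single p]
    · rw [ih, Matrix.sub_apply, hp, Matrix.smul_apply, Matrix.one_apply_eq, smul_eq_mul]
      ring
    · intro r _ hr
      rw [Matrix.sub_apply, hp, Matrix.smul_apply, Matrix.one_apply_ne hr.symm]
      simp
    · simp

/-- If `B` has a zero row, the expansion point is closer to `0` than to `1`. -/
theorem HasTaylorExpansionAt.norm_lt (h : HasTaylorExpansionAt B c) (p : ι)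
    (hp : ∀ q, B p q = 0) : ‖c‖ < ‖1 - c‖ := by
  have h3 : 0 < ‖1 - c‖ := norm_pos_iff.mpr (sub_ne_zero.mpr h.1.symm)
  by_contra! hlt
  have h1 : Filter.Tendsto (fun n : ℕ => (((1 - c) ^ (n + 1))⁻¹ •
      (B - c • (1 : Matrix ι ι ℂ)) ^ n) p p) Filter.atTop (nhds 0) :=
    ((continuous_id.matrix_elem p p).tendsto 0).comp h.tendsto_term
  have h2 := h1.norm
  rw [norm_zero] at h2
  have h4 : ‖1 - c‖⁻¹ ≤ 0 := by
    refine ge_of_tendsto' h2 fun n => ?_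
    rw [Matrix.smul_apply, sub_smul_one_pow_row p hp, Matrix.one_apply_eq, mul_one, smul_eq_mul,
      norm_mul, norm_inv, norm_pow, norm_pow, norm_neg, pow_succ, mul_inv, mul_right_comm]
    refine le_mul_of_one_le_left (by positivity) ?_
    rw [← inv_pow, ← mul_pow]
    refine one_le_pow₀ ?_
    rw [inv_mul_eq_div, one_le_div h3]
    exact hlt
  have : 0 < ‖1 - c‖⁻¹ := by positivity
  linarith

end Taylor

variable {N : ℕ} {A Z : Matrix (Fin N) (Fin N) ℂ} {d : Fin N → ℂ}

theorem kappa_nonneg (Z : Matrix (Fin N) (Fin N) ℂ) : 0 ≤ kappa Z := by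
  rw [kappa]; positivity

theorem bigK_nonneg (A : Matrix (Fin N) (Fin N) ℂ) (M : ℕ) (c : ℂ) : 0 ≤ bigK A M c := by
  rw [bigK]; positivity

/-- The error bound under the condition that the Taylor series of the exponential converges. -/
theorem truncError_le_of_lt (hZ : IsUnit Z) (hA : A = Z * Matrix.diagonal d * Z⁻¹) {M : ℕ}
    (hM : 2 ≤ M) {c : ℂ} (hc : c ≠ 0) (hT : HasTaylorExpansionAt (A ⊗ₖ coeffMatrix M) c)
    (hlt : ‖c‖ * mu A M c < ‖1 - c‖) {t : ℝ} (ht : t ∈ Set.Icc (-1 : ℝ) 1) :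
    truncError A M t ≤ kappa Z * bigK A M c * (M : ℝ) *
      ‖c * ((mu A M c : ℝ) : ℂ) / (1 - c)‖ ^ (M - 1) := by
  obtain ⟨m, rfl⟩ : ∃ m, M = m + 1 := ⟨M - 1, by omega⟩
  have hm : 1 ≤ m := by omega
  have hX := hT.mul_inv_eq_one
  have hR : ∀ k, (1 - d k • coeffMatrix (m + 1)) * (1 - d k • coeffMatrix (m + 1))⁻¹ = 1 := by
    intro k
    have := isUnit_one_sub_smul (mulVec_col_eq hZ hA k) (col_ne_zero_of_isUnit hZ k)
      (mul_eq_one_comm.mp hX)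
    exact Matrix.mul_nonsing_inv _ ((Matrix.isUnit_iff_isUnit_det _).mp this)
  have hmu : mu A (m + 1) c = Real.exp (Real.sqrt (9 * rho A / (m * ‖c‖))) := by
    rw [mu]; push_cast; rw [add_sub_cancel_right]
  have hmu0 : 0 < mu A (m + 1) c := Real.exp_pos _
  set H := ‖Ring.inverse (1 - kronHat A (m + 1))‖ with hH
  set b := ‖c‖ * mu A (m + 1) c with hb
  have hb0 : 0 ≤ b := by positivity
  have hq : ‖c * ((mu A (m + 1) c : ℝ) : ℂ) / (1 - c)‖ = b / ‖1 - c‖ := by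
    rw [norm_div, norm_mul, Complex.norm_real, Real.norm_of_nonneg hmu0.le]
  have hgap : 0 < ‖1 - c‖ - b := by linarith
  have hK : (1 / (‖1 - c‖ - b) + (m + 1 : ℕ) * H) ≤ bigK A (m + 1) c * (m + 1 : ℕ) := by
    have hm0 : (0 : ℝ) < (m + 1 : ℕ) := by positivity
    rw [bigK, ← hb, ← hH, abs_of_pos (by positivity), add_mul, mul_inv, mul_assoc,
      inv_mul_cancel₀ hm0.ne', mul_one, ← one_div]
    have : 0 ≤ H * (m + 1 : ℕ) := by positivity
    linarith
  rw [truncError, exp_smul_eq hZ hA, starApprox_eq hZ hA hR, ← sub_mul, ← mul_sub,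
    Matrix.diagonal_sub, hq, Nat.add_sub_cancel, mul_assoc (kappa Z), mul_assoc (kappa Z)]
  refine (norm_conj_diagonal_le Z (b := (1 / (‖1 - c‖ - b) + (m + 1 : ℕ) * H) *
    (b / ‖1 - c‖) ^ m) (by positivity) fun k => ?_).trans ?_
  · have h := norm_exp_sub_resolvent_le hc (norm_le_rho hZ hA k) hm (by rwa [hb, hmu] at hlt) ht
      _ (mul_eq_one_comm.mp (hR k)) H (norm_nonneg _)
      (norm_resolvent_mulVec_le (mulVec_col_eq hZ hA k) (col_ne_zero_of_isUnit hZ k) hX (hR k))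
    rwa [← hmu, ← hb] at h
  · exact mul_le_mul_of_nonneg_left (mul_le_mul_of_nonneg_right hK (by positivity))
      (kappa_nonneg Z)

theorem truncError_le (hZ : IsUnit Z) (hA : A = Z * Matrix.diagonal d * Z⁻¹) {M : ℕ}
    (hM : 2 ≤ M) {c : ℂ} (hc : c ≠ 0) (hT : HasTaylorExpansionAt (A ⊗ₖ coeffMatrix M) c)
    (hMc : 9 * rho A * (1 / ‖c‖) * (Real.log (‖1 - c‖ / ‖c‖) ^ 2)⁻¹ + 1 ≤ (M : ℝ))
    (hne : ‖1 - c‖ ≠ ‖c‖ * mu A M c) {t : ℝ} (ht : t ∈ Set.Icc (-1 : ℝ) 1) :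
    truncError A M t ≤ kappa Z * bigK A M c * (M : ℝ) *
      ‖c * ((mu A M c : ℝ) : ℂ) / (1 - c)‖ ^ (M - 1) := by
  rcases Nat.eq_zero_or_pos N with rfl | hN
  · rw [truncError, Subsingleton.elim (NormedSpace.exp _ - _) 0, norm_zero]
    have := kappa_nonneg Z
    have := bigK_nonneg A M c
    positivity
  refine truncError_le_of_lt hZ hA hM hc hT (lt_of_le_of_ne ?_ hne.symm) ht
  have hc0 : 0 < ‖c‖ := norm_pos_iff.mpr hc
  have hlt : ‖c‖ < ‖1 - c‖ := by
    refine hT.norm_lt (⟨0, hN⟩, ⟨M - 1, by omega⟩) fun q => ?_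
    rw [Matrix.kroneckerMap_apply, coeffMatrix, Matrix.of_apply, if_pos (by simp; omega), mul_zero]
  have hM0 : (0 : ℝ) < (M : ℝ) - 1 := by
    have : (2 : ℝ) ≤ M := by exact_mod_cast hM
    linarith
  have hr : 1 < ‖1 - c‖ / ‖c‖ := by rwa [one_lt_div hc0]
  have hlog : 0 < Real.log (‖1 - c‖ / ‖c‖) := Real.log_pos hr
  have h1 : Real.sqrt (9 * rho A / (((M : ℝ) - 1) * ‖c‖)) ≤ Real.log (‖1 - c‖ / ‖c‖) := by
    rw [Real.sqrt_le_left hlog.le, div_le_iff₀ (by positivity)]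
    have h2 : 9 * rho A * (1 / ‖c‖) * (Real.log (‖1 - c‖ / ‖c‖) ^ 2)⁻¹ ≤ (M : ℝ) - 1 := by
      linarith
    rw [← div_eq_mul_inv, div_le_iff₀ (by positivity), mul_one_div, div_le_iff₀ hc0] at h2
    linarith
  rw [mu]
  calc _ ≤ ‖c‖ * Real.exp (Real.log (‖1 - c‖ / ‖c‖)) := by gcongr
    _ = _ := by rw [Real.exp_log (by linarith)]; field_simp

section Centre

variable {M : ℕ}

theorem norm_centre (hρ : 0 < rho A) (hM : (1 : ℝ) < M) :
    ‖centre A M‖ = 9 * rho A / ((M : ℝ) - 1) := by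
  have : 0 < (M : ℝ) - 1 := by linarith
  rw [centre, Complex.norm_real, norm_neg, Real.norm_of_nonneg (by positivity)]

theorem norm_one_sub_centre (hρ : 0 < rho A) (hM : (1 : ℝ) < M) :
    ‖1 - centre A M‖ = 1 + 9 * rho A / ((M : ℝ) - 1) := by
  have : 0 < (M : ℝ) - 1 := by linarith
  rw [centre, ← Complex.ofReal_one, ← Complex.ofReal_sub, Complex.norm_real, sub_neg_eq_add,
    Real.norm_of_nonneg (by positivity)]

theorem mu_centre (hρ : 0 < rho A) (hM : (1 : ℝ) < M) : mu A M (centre A M) = Real.exp 1 := by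
  have : 0 < (M : ℝ) - 1 := by linarith
  rw [mu, norm_centre hρ hM, mul_div_cancel₀ _ this.ne', div_self (by positivity), Real.sqrt_one]

theorem gap_centre (hρ : 0 < rho A) (hM : 18 * rho A + 1 ≤ (M : ℝ)) :
    1 / 10 ≤ ‖1 - centre A M‖ - ‖centre A M‖ * mu A M (centre A M) := by
  have hM1 : (1 : ℝ) < M := by linarith
  have hM0 : 0 < (M : ℝ) - 1 := by linarith
  rw [mu_centre hρ hM1, norm_centre hρ hM1, norm_one_sub_centre hρ hM1]
  have h1 : 9 * rho A / ((M : ℝ) - 1) ≤ 1 / 2 := by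
    rw [div_le_div_iff₀ hM0 (by norm_num)]; linarith
  have h0 : 0 < 9 * rho A / ((M : ℝ) - 1) := by positivity
  have he := Real.exp_one_lt_d9
  nlinarith

theorem truncError_le_superBound (hZ : IsUnit Z) (hA : A = Z * Matrix.diagonal d * Z⁻¹)
    (hρ : 0 < rho A) (hM : 18 * rho A + 1 ≤ (M : ℝ))
    (hT : HasTaylorExpansionAt (A ⊗ₖ coeffMatrix M) (centre A M)) {t : ℝ}
    (ht : t ∈ Set.Icc (-1 : ℝ) 1) : truncError A M t ≤ superBound A Z M := by
  have hM1 : (1 : ℝ) < M := by linarith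
  have hM0 : 0 < (M : ℝ) - 1 := by linarith
  have hM2 : 2 ≤ M := by exact_mod_cast hM1
  have hg := gap_centre hρ hM
  have hcn : 0 < ‖centre A M‖ := by rw [norm_centre hρ hM1]; positivity
  have h := truncError_le_of_lt hZ hA hM2 (norm_pos_iff.mp hcn) hT (by linarith) ht
  refine h.trans ?_
  rw [superBound]
  have := kappa_nonneg Z
  have := bigK_nonneg A M (centre A M)
  have h2 : ‖centre A M * ((mu A M (centre A M) : ℝ) : ℂ) / (1 - centre A M)‖ ≤
      |9 * rho A * Real.exp 1 / ((M : ℝ) - 1)| := by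
    rw [norm_div, norm_mul, Complex.norm_real, mu_centre hρ hM1, norm_centre hρ hM1,
      norm_one_sub_centre hρ hM1, Real.norm_of_nonneg (Real.exp_pos 1).le,
      abs_of_nonneg (by positivity)]
    refine (div_le_self (by positivity) ?_).trans (le_of_eq (by ring))
    have : 0 ≤ 9 * rho A / ((M : ℝ) - 1) := by positivity
    linarith
  gcongr

end Centre

/-- An `L¹` stability estimate for the integral equation `u = w + λ ∫ u`. -/
theorem integral_norm_le_of_hasDerivAt (lam : ℂ) {U u : ℝ → ℂ} (hU : ∀ t, HasDerivAt U (u t) t)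
    (hu : Continuous u) (h0 : U (-1) = 0) :
    ∫ t in (-1 : ℝ)..1, ‖u t‖ ≤ (1 + 2 * ‖lam‖ * Real.exp (4 * ‖lam‖)) *
      ∫ t in (-1 : ℝ)..1, ‖u t - lam * U t‖ := by
  have hUc : Continuous U := continuous_iff_continuousAt.mpr fun t => (hU t).continuousAt
  set w : ℝ → ℂ := fun t => u t - lam * U t with hw
  have hwc : Continuous w := hu.sub (continuous_const.mul hUc)
  set J := ∫ t in (-1 : ℝ)..1, ‖w t‖ with hJ
  have hwi : ∀ a b, IntervalIntegrable (fun t => ‖w t‖) MeasureTheory.volume a b :=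
    fun a b => hwc.norm.intervalIntegrable a b
  have hexpn : ∀ (z : ℂ) (s : ℝ), ‖z‖ = ‖lam‖ → s ∈ Set.Icc (-1 : ℝ) 1 →
      ‖Complex.exp (z * ((s + 1 : ℝ) : ℂ))‖ ≤ Real.exp (2 * ‖lam‖) := by
    intro z s hz hs
    refine (Complex.norm_exp_le_exp_norm _).trans (Real.exp_le_exp.mpr ?_)
    rw [norm_mul, Complex.norm_real, Real.norm_of_nonneg (by linarith [hs.1]), hz, mul_comm]
    exact mul_le_mul_of_nonneg_right (by linarith [hs.2]) (norm_nonneg _)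
  have hE : ∀ t : ℝ, HasDerivAt (fun s : ℝ => Complex.exp (-lam * ((s + 1 : ℝ) : ℂ)))
      (Complex.exp (-lam * ((t + 1 : ℝ) : ℂ)) * (-lam)) t := by
    intro t
    have h1 : HasDerivAt (fun s : ℝ => ((s + 1 : ℝ) : ℂ)) 1 t := by
      have := ((hasDerivAt_id t).add_const (1 : ℝ)).ofReal_comp
      simpa using this
    have h2 := (h1.const_mul (-lam)).cexp
    simpa using h2
  have hEc : Continuous (fun s : ℝ => Complex.exp (-lam * ((s + 1 : ℝ) : ℂ))) := by fun_prop
  have hV : ∀ t : ℝ, HasDerivAt (fun s : ℝ => Complex.exp (-lam * ((s + 1 : ℝ) : ℂ)) * U s)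
      (Complex.exp (-lam * ((t + 1 : ℝ) : ℂ)) * w t) t := by
    intro t
    have h := (hE t).mul (hU t)
    refine h.congr_deriv ?_
    simp only [hw]; ring
  have hUb : ∀ t ∈ Set.Icc (-1 : ℝ) 1, ‖U t‖ ≤ Real.exp (4 * ‖lam‖) * J := by
    intro t ht
    have hI := intervalIntegral.integral_eq_sub_of_hasDerivAt (a := -1) (b := t)
      (fun s _ => hV s) ((hEc.mul hwc).intervalIntegrable _ _)
    rw [h0, mul_zero, sub_zero] at hI
    have hVb : ‖Complex.exp (-lam * ((t + 1 : ℝ) : ℂ)) * U t‖ ≤ Real.exp (2 * ‖lam‖) * J := by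
      rw [← hI]
      calc _ ≤ ∫ s in (-1 : ℝ)..t, Real.exp (2 * ‖lam‖) * ‖w s‖ := by
            refine intervalIntegral.norm_integral_le_of_norm_le ht.1 ?_ ((hwi _ _).const_mul _)
            refine Filter.Eventually.of_forall fun s hs => ?_
            rw [norm_mul]
            exact mul_le_mul_of_nonneg_right
              (hexpn _ s (norm_neg _) ⟨hs.1.le, hs.2.trans ht.2⟩) (norm_nonneg _)
        _ = Real.exp (2 * ‖lam‖) * ∫ s in (-1 : ℝ)..t, ‖w s‖ := by
            rw [intervalIntegral.integral_const_mul]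
        _ ≤ _ := by
            refine mul_le_mul_of_nonneg_left ?_ (Real.exp_pos _).le
            rw [hJ, ← intervalIntegral.integral_add_adjacent_intervals (hwi (-1) t) (hwi t 1)]
            have := intervalIntegral.integral_nonneg (μ := MeasureTheory.volume) ht.2
              (fun s _ => norm_nonneg (w s))
            linarith
    have e : U t = Complex.exp (lam * ((t + 1 : ℝ) : ℂ)) *
        (Complex.exp (-lam * ((t + 1 : ℝ) : ℂ)) * U t) := by
      rw [← mul_assoc, ← Complex.exp_add, neg_mul, add_neg_cancel, Complex.exp_zero, one_mul]
    rw [e, norm_mul]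
    calc _ ≤ Real.exp (2 * ‖lam‖) * (Real.exp (2 * ‖lam‖) * J) :=
          mul_le_mul (hexpn _ t rfl ht) hVb (norm_nonneg _) (Real.exp_pos _).le
      _ = _ := by rw [← mul_assoc, ← Real.exp_add]; ring_nf
  have hle : ∫ t in (-1 : ℝ)..1, ‖u t‖ ≤
      ∫ t in (-1 : ℝ)..1, (‖w t‖ + ‖lam‖ * (Real.exp (4 * ‖lam‖) * J)) := by
    apply intervalIntegral.integral_mono_on (by norm_num) (hu.norm.intervalIntegrable _ _)
      ((hwc.norm.add continuous_const).intervalIntegrable _ _)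
    intro t ht
    have e : u t = w t + lam * U t := by simp only [hw]; ring
    rw [e]
    refine (norm_add_le _ _).trans ?_
    rw [norm_mul]
    exact add_le_add le_rfl (mul_le_mul_of_nonneg_left (hUb t ht) (norm_nonneg _))
  rw [intervalIntegral.integral_add (hwi _ _) (by simp), intervalIntegral.integral_const,
    ← hJ] at hle
  refine hle.trans (le_of_eq ?_)
  rw [smul_eq_mul]; ring

/-- The function with given Legendre coefficients. -/
noncomputable def legendreSeries {M : ℕ} (x : Fin M → ℂ) (t : ℝ) : ℂ :=
  ∑ l, x l * (((orthoPoly l).eval t : ℝ) : ℂ)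

theorem continuous_legendreSeries {M : ℕ} (x : Fin M → ℂ) : Continuous (legendreSeries x) := by
  unfold legendreSeries
  exact continuous_finsetSum _ fun l _ =>
    continuous_const.mul (Complex.continuous_ofReal.comp (orthoPoly l).continuous)

theorem integral_legendreSeries_mul {M : ℕ} (x : Fin M → ℂ) (g : Polynomial ℝ) :
    ∫ t in (-1 : ℝ)..1, legendreSeries x t * ((g.eval t : ℝ) : ℂ) =
      ∑ l, x l * ((∫ t in (-1 : ℝ)..1, (orthoPoly l * g).eval t : ℝ) : ℂ) := by
  simp only [legendreSeries, Finset.sum_mul, mul_assoc, ← Complex.ofReal_mul, ← Polynomial.eval_mul]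
  rw [intervalIntegral.integral_finsetSum]
  · refine Finset.sum_congr rfl fun l _ => ?_
    rw [intervalIntegral.integral_const_mul, intervalIntegral.integral_ofReal]
  · intro l _
    exact (continuous_const.mul (Complex.continuous_ofReal.comp
      (Polynomial.continuous _))).intervalIntegrable _ _

theorem norm_integral_legendreSeries_mul_le {M : ℕ} (x : Fin M → ℂ) (g : Polynomial ℝ) {b : ℝ}
    (hg : ∀ t ∈ Set.Icc (-1 : ℝ) 1, |g.eval t| ≤ b) :
    ‖∫ t in (-1 : ℝ)..1, legendreSeries x t * ((g.eval t : ℝ) : ℂ)‖ ≤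
      b * ∫ t in (-1 : ℝ)..1, ‖legendreSeries x t‖ := by
  rw [← intervalIntegral.integral_const_mul]
  refine intervalIntegral.norm_integral_le_of_norm_le (by norm_num) ?_
    ((continuous_const.mul (continuous_legendreSeries x).norm).intervalIntegrable _ _)
  refine Filter.Eventually.of_forall fun s hs => ?_
  rw [norm_mul, mul_comm, Complex.norm_real, Real.norm_eq_abs]
  exact mul_le_mul_of_nonneg_right (hg s ⟨hs.1.le, hs.2⟩) (norm_nonneg _)

theorem norm_coef_le {M : ℕ} (x : Fin M → ℂ) (k : Fin M) :
    ‖x k‖ ≤ M * ∫ t in (-1 : ℝ)..1, ‖legendreSeries x t‖ := by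
  have h := norm_integral_legendreSeries_mul_le x (orthoPoly k) (b := M) (by
    intro t ht
    rw [orthoPoly_eval]
    refine (abs_orthoLegendre_le ht).trans ?_
    have hk : ((k : ℕ) : ℝ) + 1 ≤ M := by exact_mod_cast k.2
    have hk0 : (0 : ℝ) ≤ ((k : ℕ) : ℝ) := by positivity
    rw [Real.sqrt_le_left (by linarith)]
    nlinarith)
  rw [integral_legendreSeries_mul] at h
  simp only [integral_orthoPoly_mul] at h
  have e : ∑ l, x l * (((if (l : ℕ) = k then 1 else 0 : ℝ)) : ℂ) = x k := by
    rw [Finset.sum_eq_single k]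
    · simp
    · intro l _ hl
      rw [if_neg (fun h => hl (Fin.ext h))]; simp
    · simp
  rwa [e] at h

theorem norm_sum_coeffInf_mul_le {M j : ℕ} (hj : j ≠ 0) (x : Fin M → ℂ) :
    ‖∑ l, x l * ((coeffInf j l : ℝ) : ℂ)‖ ≤
      1 / Real.sqrt j * ∫ t in (-1 : ℝ)..1, ‖legendreSeries x t‖ := by
  have h := norm_integral_legendreSeries_mul_le x (primitive (orthoPoly j))
    (fun t ht => abs_primitive_orthoPoly_le hj ht)
  rw [integral_legendreSeries_mul, ← norm_neg, ← Finset.sum_neg_distrib] at h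
  simpa only [coeffInf_eq_neg_integral hj, Complex.ofReal_neg, mul_neg] using h

/-- The primitive of `legendreSeries x` that vanishes at `-1`. -/
noncomputable def legendreSeriesPrim {M : ℕ} (x : Fin M → ℂ) (t : ℝ) : ℂ :=
  ∑ l, x l * (((primitive (orthoPoly l)).eval t : ℝ) : ℂ)

theorem hasDerivAt_legendreSeriesPrim {M : ℕ} (x : Fin M → ℂ) (t : ℝ) :
    HasDerivAt (legendreSeriesPrim x) (legendreSeries x t) t := by
  unfold legendreSeriesPrim legendreSeries
  refine HasDerivAt.fun_sum fun l _ => HasDerivAt.const_mul _ ?_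
  have h := (primitive (orthoPoly l)).hasDerivAt t
  rw [derivative_primitive] at h
  exact h.ofReal_comp

theorem degree_orthoPoly_lt {l M : ℕ} (h : l < M) : (orthoPoly l).degree < M := by
  rw [orthoPoly, Polynomial.degree_C_mul (by positivity)]
  have : (legendre l).degree = l := legendreSequence.degree_eq l
  rw [this]
  exact_mod_cast h

theorem legendreSeriesPrim_eq {M : ℕ} (x : Fin M → ℂ) (t : ℝ) :
    legendreSeriesPrim x t = ∑ k ∈ Finset.range (M + 1),
      (∑ l, x l * ((coeffInf k l : ℝ) : ℂ)) * ((orthoLegendre k t : ℝ) : ℂ) := by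
  simp only [Finset.sum_mul]
  rw [Finset.sum_comm, legendreSeriesPrim]
  refine Finset.sum_congr rfl fun l _ => ?_
  conv_lhs => rw [eq_sum_orthoCoef (degree_primitive_lt (degree_orthoPoly_lt l.2)),
    Polynomial.eval_finsetSum]
  push_cast
  rw [Finset.mul_sum]
  refine Finset.sum_congr rfl fun k _ => ?_
  rw [Polynomial.eval_mul, Polynomial.eval_C, orthoPoly_eval, coeffInf_eq]
  push_cast
  ring

theorem legendreSeries_sub_prim {m : ℕ} (lam : ℂ) (x : Fin (m + 1) → ℂ) (t : ℝ) :
    legendreSeries x t - lam * legendreSeriesPrim x t =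
      legendreSeries ((1 - lam • coeffMatrix (m + 1)).mulVec x) t -
      lam * ((∑ l, x l * ((coeffInf m l : ℝ) : ℂ)) * ((orthoLegendre m t : ℝ) : ℂ) +
        (∑ l, x l * ((coeffInf (m + 1) l : ℝ) : ℂ)) * ((orthoLegendre (m + 1) t : ℝ) : ℂ)) := by
  have hy : ∀ k : Fin (m + 1), ((1 - lam • coeffMatrix (m + 1)).mulVec x) k =
      x k - lam * (if (k : ℕ) = m then 0 else ∑ l, x l * ((coeffInf k l : ℝ) : ℂ)) := by
    intro k
    rw [Matrix.sub_mulVec, Matrix.one_mulVec, Matrix.smul_mulVec, Pi.sub_apply, Pi.smul_apply,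
      smul_eq_mul, Matrix.mulVec, dotProduct]
    simp only [coeffMatrix, Matrix.of_apply, Nat.add_right_cancel_iff]
    split_ifs with h
    · simp
    · simp only [mul_comm]
  rw [legendreSeriesPrim_eq, Finset.sum_range_succ, legendreSeries, legendreSeries]
  simp only [hy, orthoPoly_eval, sub_mul, Finset.sum_sub_distrib, mul_assoc lam]
  rw [← Finset.mul_sum, Fin.sum_univ_eq_sum_range (fun k : ℕ =>
    (if k = m then 0 else ∑ l, x l * ((coeffInf k l : ℝ) : ℂ)) * ((orthoLegendre k t : ℝ) : ℂ)),
    Finset.sum_range_succ, Finset.sum_range_succ]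
  have e : ∑ k ∈ Finset.range m, (if k = m then 0 else ∑ l, x l * ((coeffInf k l : ℝ) : ℂ)) *
      ((orthoLegendre k t : ℝ) : ℂ) = ∑ k ∈ Finset.range m,
      (∑ l, x l * ((coeffInf k l : ℝ) : ℂ)) * ((orthoLegendre k t : ℝ) : ℂ) :=
    Finset.sum_congr rfl fun k hk => by rw [if_neg (Finset.mem_range.mp hk).ne]
  rw [e, if_pos rfl]
  ring

theorem integral_norm_mul_orthoLegendre_le (a : ℂ) (k : ℕ) :
    ∫ t in (-1 : ℝ)..1, ‖a * ((orthoLegendre k t : ℝ) : ℂ)‖ ≤ 2 * ‖a‖ := by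
  simp only [norm_mul, Complex.norm_real, Real.norm_eq_abs]
  rw [intervalIntegral.integral_const_mul, mul_comm]
  exact mul_le_mul_of_nonneg_right (integral_abs_orthoLegendre_le k) (norm_nonneg _)

theorem continuous_orthoLegendre (k : ℕ) : Continuous (orthoLegendre k) := by
  simp only [← funext (orthoPoly_eval k)]
  exact (orthoPoly k).continuous

theorem integral_norm_legendreSeries_le {M : ℕ} (y : Fin M → ℂ) :
    ∫ t in (-1 : ℝ)..1, ‖legendreSeries y t‖ ≤ 2 * ∑ l, ‖y l‖ := by
  have hc : ∀ l : Fin M, Continuous fun t => ‖y l * ((orthoLegendre l t : ℝ) : ℂ)‖ := fun l =>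
    (continuous_const.mul (Complex.continuous_ofReal.comp (continuous_orthoLegendre l))).norm
  calc _ ≤ ∫ t in (-1 : ℝ)..1, ∑ l, ‖y l * ((orthoLegendre l t : ℝ) : ℂ)‖ := by
        apply intervalIntegral.integral_mono_on (by norm_num)
          ((continuous_legendreSeries y).norm.intervalIntegrable _ _)
          ((continuous_finsetSum _ fun l _ => hc l).intervalIntegrable _ _)
        intro t _
        simp only [legendreSeries, orthoPoly_eval]
        exact norm_sum_le _ _
    _ = ∑ l, ∫ t in (-1 : ℝ)..1, ‖y l * ((orthoLegendre l t : ℝ) : ℂ)‖ :=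
        intervalIntegral.integral_finsetSum fun l _ => (hc l).intervalIntegrable _ _
    _ ≤ ∑ l, 2 * ‖y l‖ := Finset.sum_le_sum fun l _ => integral_norm_mul_orthoLegendre_le _ _
    _ = _ := by rw [Finset.mul_sum]

/-- Uniform stability of the truncated scalar equation. -/
theorem exists_norm_le_of_mulVec (lam : ℂ) : ∃ C : ℝ, 0 ≤ C ∧ ∀ᶠ m : ℕ in Filter.atTop,
    ∀ (x : Fin (m + 1) → ℂ) (k : Fin (m + 1)), ‖x k‖ ≤
      C * (m + 1 : ℕ) * ∑ l, ‖((1 - lam • coeffMatrix (m + 1)).mulVec x) l‖ := by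
  set B := 1 + 2 * ‖lam‖ * Real.exp (4 * ‖lam‖) with hB
  have hB0 : 0 < B := by positivity
  refine ⟨4 * B, by positivity, ?_⟩
  have hlim : Filter.Tendsto (fun m : ℕ => 4 * B * ‖lam‖ * (1 / Real.sqrt m)) Filter.atTop
      (nhds (4 * B * ‖lam‖ * 0)) := by
    refine Filter.Tendsto.const_mul _ ?_
    simp only [one_div]
    exact tendsto_inv_atTop_zero.comp
      (Real.tendsto_sqrt_atTop.comp tendsto_natCast_atTop_atTop)
  rw [mul_zero] at hlim
  filter_upwards [hlim.eventually_le_const (u := 1 / 2) (by norm_num),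
    Filter.eventually_ge_atTop 1] with m hm hm1 x k
  set y := (1 - lam • coeffMatrix (m + 1)).mulVec x with hy
  set I := ∫ t in (-1 : ℝ)..1, ‖legendreSeries x t‖ with hI
  have hI0 : 0 ≤ I := intervalIntegral.integral_nonneg (by norm_num) fun t _ => norm_nonneg _
  set a := ∑ l, x l * ((coeffInf m l : ℝ) : ℂ) with ha
  set b := ∑ l, x l * ((coeffInf (m + 1) l : ℝ) : ℂ) with hb
  have ha1 : ‖a‖ ≤ 1 / Real.sqrt m * I := norm_sum_coeffInf_mul_le (by omega) x
  have hb1 : ‖b‖ ≤ 1 / Real.sqrt m * I := by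
    refine (norm_sum_coeffInf_mul_le (by omega) x).trans ?_
    have : (0 : ℝ) < m := by exact_mod_cast hm1
    gcongr
    omega
  have h1 := integral_norm_le_of_hasDerivAt lam (hasDerivAt_legendreSeriesPrim x)
    (continuous_legendreSeries x) (by simp [legendreSeriesPrim, primitive_eval_neg_one])
  have hcy := continuous_legendreSeries y
  have hca : ∀ (z : ℂ) (j : ℕ), Continuous fun t => z * ((orthoLegendre j t : ℝ) : ℂ) :=
    fun z j => continuous_const.mul (Complex.continuous_ofReal.comp (continuous_orthoLegendre j))
  have h2 : ∫ t in (-1 : ℝ)..1, ‖legendreSeries x t - lam * legendreSeriesPrim x t‖ ≤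
      2 * ∑ l, ‖y l‖ + ‖lam‖ * (2 * ‖a‖ + 2 * ‖b‖) := by
    calc _ ≤ ∫ t in (-1 : ℝ)..1, (‖legendreSeries y t‖ + ‖lam‖ *
          (‖a * ((orthoLegendre m t : ℝ) : ℂ)‖ + ‖b * ((orthoLegendre (m + 1) t : ℝ) : ℂ)‖)) := by
          simp only [legendreSeries_sub_prim]
          apply intervalIntegral.integral_mono_on (by norm_num)
          · exact (hcy.sub (continuous_const.mul ((hca a m).add (hca b (m + 1))))).norm
              |>.intervalIntegrable _ _
          · exact (hcy.norm.add (continuous_const.mul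
              ((hca a m).norm.add (hca b (m + 1)).norm))).intervalIntegrable _ _
          · intro t _
            refine (norm_sub_le _ _).trans ?_
            rw [norm_mul lam]
            gcongr
            exact norm_add_le _ _
      _ = (∫ t in (-1 : ℝ)..1, ‖legendreSeries y t‖) + ‖lam‖ *
          ((∫ t in (-1 : ℝ)..1, ‖a * ((orthoLegendre m t : ℝ) : ℂ)‖) +
            ∫ t in (-1 : ℝ)..1, ‖b * ((orthoLegendre (m + 1) t : ℝ) : ℂ)‖) := by
          rw [← intervalIntegral.integral_add ((hca a m).norm.intervalIntegrable _ _)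
              ((hca b (m + 1)).norm.intervalIntegrable _ _),
            ← intervalIntegral.integral_const_mul]
          exact intervalIntegral.integral_add (hcy.norm.intervalIntegrable _ _)
            ((continuous_const.mul ((hca a m).norm.add (hca b (m + 1)).norm)).intervalIntegrable
              _ _)
      _ ≤ _ := by
          gcongr
          · exact integral_norm_legendreSeries_le y
          · exact integral_norm_mul_orthoLegendre_le _ _
          · exact integral_norm_mul_orthoLegendre_le _ _
  have h3 : I ≤ 4 * B * ∑ l, ‖y l‖ := by
    have h4 : B * (‖lam‖ * (2 * ‖a‖ + 2 * ‖b‖)) ≤ 1 / 2 * I := by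
      calc _ ≤ B * (‖lam‖ * (2 * (1 / Real.sqrt m * I) + 2 * (1 / Real.sqrt m * I))) := by gcongr
        _ = 4 * B * ‖lam‖ * (1 / Real.sqrt m) * I := by ring
        _ ≤ _ := by gcongr
    have h5 := h1.trans (mul_le_mul_of_nonneg_left h2 hB0.le)
    rw [mul_add] at h5
    linarith
  calc ‖x k‖ ≤ (m + 1 : ℕ) * I := norm_coef_le x k
    _ ≤ (m + 1 : ℕ) * (4 * B * ∑ l, ‖y l‖) := by gcongr
    _ = _ := by ring

theorem exists_resolvent_entry_le (lam : ℂ) : ∃ C : ℝ, 0 ≤ C ∧ ∀ᶠ m : ℕ in Filter.atTop,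
    ∃ R : Matrix (Fin (m + 1)) (Fin (m + 1)) ℂ, (1 - lam • coeffMatrix (m + 1)) * R = 1 ∧
      ∀ k l, ‖R k l‖ ≤ C * (m + 1 : ℕ) := by
  obtain ⟨C, hC, h⟩ := exists_norm_le_of_mulVec lam
  refine ⟨C, hC, ?_⟩
  filter_upwards [h] with m hm
  have hu : IsUnit (1 - lam • coeffMatrix (m + 1)).det := by
    rw [isUnit_iff_ne_zero]
    intro hdet
    obtain ⟨x, hx0, hx⟩ := Matrix.exists_mulVec_eq_zero_iff.mpr hdet
    refine hx0 (funext fun k => ?_)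
    have := hm x k
    rw [hx] at this
    simpa using this
  refine ⟨(1 - lam • coeffMatrix (m + 1))⁻¹, Matrix.mul_nonsing_inv _ hu, fun k l => ?_⟩
  have := hm ((1 - lam • coeffMatrix (m + 1))⁻¹.mulVec (Pi.single l 1)) k
  rw [Matrix.mulVec_mulVec, Matrix.mul_nonsing_inv _ hu, Matrix.one_mulVec,
    Matrix.mulVec_single_one] at this
  refine this.trans (le_of_eq ?_)
  have e : ∑ i, ‖(Pi.single l (1 : ℂ) : Fin (m + 1) → ℂ) i‖ = 1 := by
    rw [Finset.sum_eq_single l] <;> simp +contextual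
  rw [e, mul_one]

/-- The resolvents grow at most polynomially with the truncation index. -/
theorem exists_norm_inverse_le (hZ : IsUnit Z) (hA : A = Z * Matrix.diagonal d * Z⁻¹) :
    ∃ D : ℝ, 0 ≤ D ∧ ∀ᶠ M : ℕ in Filter.atTop,
      ‖Ring.inverse (1 - kronHat A M)‖ ≤ D * (M : ℝ) ^ 3 := by
  choose C hC hR using fun k => exists_resolvent_entry_le (d k)
  set S : ℝ := ∑ k, (∑ i, ∑ j, ‖specProj Z k i j‖) * C k with hS
  have hS0 : 0 ≤ S := Finset.sum_nonneg fun k _ => mul_nonneg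
    (Finset.sum_nonneg fun i _ => Finset.sum_nonneg fun j _ => norm_nonneg _) (hC k)
  refine ⟨1 + (N : ℝ) ^ 2 * (S + 1), by positivity, ?_⟩
  have hall := Filter.eventually_all.mpr hR
  obtain ⟨m0, hm0⟩ := Filter.eventually_atTop.mp hall
  filter_upwards [Filter.eventually_ge_atTop (m0 + 1)] with M hM
  obtain ⟨m, rfl⟩ : ∃ m, M = m + 1 := ⟨M - 1, by omega⟩
  choose R hR1 hR2 using hm0 m (by omega)
  have hX := one_sub_kronecker_mul_sum hZ hA hR1
  set X := ∑ k, specProj Z k ⊗ₖ R k with hXdef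
  have hm1 : (1 : ℝ) ≤ (m + 1 : ℕ) := by exact_mod_cast Nat.succ_le_succ (Nat.zero_le m)
  have hent : ∀ p q, ‖(X - 1) p q‖ ≤ (S + 1) * (m + 1 : ℕ) := by
    intro p q
    have h1 : ‖X p q‖ ≤ S * (m + 1 : ℕ) := by
      rw [hXdef, Matrix.sum_apply, hS, Finset.sum_mul]
      refine (norm_sum_le _ _).trans (Finset.sum_le_sum fun k _ => ?_)
      rw [Matrix.kroneckerMap_apply, norm_mul, mul_assoc]
      refine mul_le_mul ?_ (hR2 k _ _) (norm_nonneg _)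
        (Finset.sum_nonneg fun i _ => Finset.sum_nonneg fun j _ => norm_nonneg _)
      exact (Finset.single_le_sum (f := fun j => ‖specProj Z k p.1 j‖)
        (fun j _ => norm_nonneg _) (Finset.mem_univ q.1)).trans
        (Finset.single_le_sum (f := fun i => ∑ j, ‖specProj Z k i j‖)
          (fun i _ => Finset.sum_nonneg fun j _ => norm_nonneg _) (Finset.mem_univ p.1))
    have h2 : ‖(1 : Matrix (Fin N × Fin (m + 1)) (Fin N × Fin (m + 1)) ℂ) p q‖ ≤ 1 := by
      rw [Matrix.one_apply]; split_ifs <;> simp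
    rw [Matrix.sub_apply, add_mul, one_mul]
    exact (norm_sub_le _ _).trans (add_le_add h1 (h2.trans hm1))
  rw [kronHat_eq_extendOp, inverse_one_sub_extendOp hX]
  have h3 : ‖extendOp (X - 1)‖ ≤ (N : ℝ) ^ 2 * (S + 1) * ((m + 1 : ℕ) : ℝ) ^ 3 := by
    refine (norm_extendOp_le _).trans ((Finset.sum_le_sum fun p _ =>
      Finset.sum_le_sum fun q _ => hent p q).trans (le_of_eq ?_))
    simp only [Finset.sum_const, Finset.card_univ, Fintype.card_prod, Fintype.card_fin, nsmul_eq_mul]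
    push_cast
    ring
  have h4 : ‖(1 : Ell2 N →L[ℂ] Ell2 N)‖ ≤ 1 := ContinuousLinearMap.norm_id_le
  have h5 : (1 : ℝ) ≤ ((m + 1 : ℕ) : ℝ) ^ 3 := one_le_pow₀ hm1
  calc _ ≤ 1 + (N : ℝ) ^ 2 * (S + 1) * ((m + 1 : ℕ) : ℝ) ^ 3 :=
        (norm_add_le _ _).trans (add_le_add h4 h3)
    _ ≤ _ := by rw [add_mul, one_mul]; gcongr

theorem superBound_nonneg (A Z : Matrix (Fin N) (Fin N) ℂ) (M : ℕ) : 0 ≤ superBound A Z M := by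
  have := kappa_nonneg Z
  have := bigK_nonneg A M (centre A M)
  rw [superBound]
  positivity

theorem tendsto_superBound_div_pow (hZ : IsUnit Z) (hA : A = Z * Matrix.diagonal d * Z⁻¹)
    (hρ : 0 < rho A) {r : ℝ} (hr : 0 < r) :
    Filter.Tendsto (fun M : ℕ => superBound A Z M / r ^ M) Filter.atTop (nhds 0) := by
  obtain ⟨D, hD, hinv⟩ := exists_norm_inverse_le hZ hA
  have hκ := kappa_nonneg Z
  set a := 9 * rho A * Real.exp 1 with ha
  have ha0 : 0 < a := by positivity
  have hlim : Filter.Tendsto (fun M : ℕ => kappa Z * (10 + 28 * D) / r * 2 *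
      ((M : ℝ) ^ 4 * (1 / 2 : ℝ) ^ M)) Filter.atTop (nhds 0) := by
    have := (tendsto_pow_const_mul_const_pow_of_abs_lt_one 4 (r := (1 / 2 : ℝ))
      (by rw [abs_of_pos] <;> norm_num)).const_mul (kappa Z * (10 + 28 * D) / r * 2)
    rwa [mul_zero] at this
  refine squeeze_zero' (Filter.Eventually.of_forall fun M =>
    div_nonneg (superBound_nonneg A Z M) (by positivity)) ?_ hlim
  filter_upwards [hinv,
    tendsto_natCast_atTop_atTop.eventually_ge_atTop (18 * rho A + 1),
    tendsto_natCast_atTop_atTop.eventually_ge_atTop (2 * a / r + 1)] with M hH hM1 hM2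
  have hM : (1 : ℝ) < M := by linarith
  have hM0 : 0 < (M : ℝ) - 1 := by linarith
  obtain ⟨m, rfl⟩ : ∃ m, M = m + 1 := ⟨M - 1, by
    have : 1 < M := by exact_mod_cast hM
    omega⟩
  have hK : bigK A (m + 1) (centre A (m + 1)) ≤ (10 + 28 * D) * ((m + 1 : ℕ) : ℝ) ^ 3 := by
    have hg := gap_centre hρ hM1
    have h1 : (1 : ℝ) / 10 ≤ (‖1 - centre A (m + 1)‖ -
        ‖centre A (m + 1)‖ * mu A (m + 1) (centre A (m + 1))) * ((m + 1 : ℕ) : ℝ) := by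
      nlinarith
    have h2 : (1 : ℝ) ≤ ((m + 1 : ℕ) : ℝ) ^ 3 := one_le_pow₀ hM.le
    have h3 : |(‖1 - centre A (m + 1)‖ -
        ‖centre A (m + 1)‖ * mu A (m + 1) (centre A (m + 1))) * ((m + 1 : ℕ) : ℝ)|⁻¹ ≤ 10 := by
      rw [abs_of_pos (by linarith)]
      exact inv_le_of_inv_le₀ (by norm_num) (by rw [← one_div]; exact h1)
    rw [bigK]
    linarith
  have hpow : |9 * rho A * Real.exp 1 / (((m + 1 : ℕ) : ℝ) - 1)| ^ m ≤ (r / 2) ^ m := by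
    rw [← ha, abs_of_nonneg (by positivity)]
    refine pow_le_pow_left₀ (by positivity) ?_ m
    rw [div_le_iff₀ hM0]
    have : 2 * a / r ≤ ((m + 1 : ℕ) : ℝ) - 1 := by linarith
    rw [div_le_iff₀ hr] at this
    linarith
  rw [superBound, Nat.add_sub_cancel, div_le_iff₀ (by positivity)]
  calc _ ≤ kappa Z * ((10 + 28 * D) * ((m + 1 : ℕ) : ℝ) ^ 3) * ((m + 1 : ℕ) : ℝ) *
        (r / 2) ^ m := by gcongr
    _ = _ := by
      rw [pow_succ r, pow_succ (1 / 2 : ℝ), div_pow, div_pow, one_pow]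
      field_simp

end StarMethod

theorem mainTheorem1 (N : ℕ) (A Z : Matrix (Fin N) (Fin N) ℂ) (d : Fin N → ℂ)
    (hZ : IsUnit Z) (hA : A = Z * Matrix.diagonal d * Z⁻¹) :
    (∀ (M : ℕ) (c : ℂ), 2 ≤ M → c ≠ 0 →
      StarMethod.HasTaylorExpansionAt (A ⊗ₖ StarMethod.coeffMatrix M) c →
      9 * StarMethod.rho A * (1 / ‖c‖) * (Real.log (‖1 - c‖ / ‖c‖) ^ 2)⁻¹ + 1 ≤ (M : ℝ) →
      ‖1 - c‖ ≠ ‖c‖ * StarMethod.mu A M c →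
      ∀ t ∈ Set.Icc (-1 : ℝ) 1,
        StarMethod.truncError A M t ≤
          StarMethod.kappa Z * StarMethod.bigK A M c * (M : ℝ) *
            ‖c * ((StarMethod.mu A M c : ℝ) : ℂ) / (1 - c)‖ ^ (M - 1)) ∧
    (0 < StarMethod.rho A →
      (∀ M : ℕ, 18 * StarMethod.rho A + 1 ≤ (M : ℝ) →
        StarMethod.HasTaylorExpansionAt (A ⊗ₖ StarMethod.coeffMatrix M)
          (StarMethod.centre A M) →
        ∀ t ∈ Set.Icc (-1 : ℝ) 1,
          StarMethod.truncError A M t ≤ StarMethod.superBound A Z M) ∧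
      (∀ r : ℝ, 0 < r →
        Filter.Tendsto (fun M : ℕ => StarMethod.superBound A Z M / r ^ M)
          Filter.atTop (nhds 0))) := by
  refine ⟨fun M c hM hc hT hMc hne t ht =>
    StarMethod.truncError_le hZ hA hM hc hT hMc hne ht, fun hρ => ⟨fun M hM hT t ht =>
    StarMethod.truncError_le_superBound hZ hA hρ hM hT ht, fun r hr =>
    StarMethod.tendsto_superBound_div_pow hZ hA hρ hr⟩⟩
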